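/- Let $E\subset\mathbb C^{\mathbb Z}$ be a Banach space of complex sequences containing the set $F(\mathbb Z)$ of finitely supported sequences, such that (H1) $F(\mathbb Z)$ is dense in $E$; (H2) $x\mapsto x(n)$ is continuous on $E$ for every $n\in\mathbb Z$; (H3) for every $z\in\mathbb C$ with $|z|=1$ the map $\psi_z:(x(n))_n\mapsto(x(n)z^n)_n$ sends $E$ into $E$, and $\sup_{|z|=1}\|\psi_z\|<\infty$. Let $S$ be the shift, $(Sx)(n)=x(n-1)$, and suppose that $S(E)\subset E$ or $S^{-1}(E)\subset E$. Let $\sigma(S)$ be the spectrum of $S|_E$ if $S(E)\subset E$, and otherwise the spectrum of the smallest closed extension of $S|_{F(\mathbb Z)}$. A multiplier is a bounded operator $M$ on $E$ with $MSa=SMa$ for all $a\in F(\mathbb Z)$. Put $\widehat M=M(e_0)$, where $e_0(0)=1$ and $e_0(n)=0$ for $n\ne0$. The symbol of $M$ is the function $\widetilde M(z)=\sum_{n\in\mathbb Z}\widehat M(n)z^n$ on $\sigma(S)$: in the interior of $\sigma(S)$ it is the sum of the series (with $0^n=0$ for $n\neq 0$ if $z=0$), and on every circle $C_r=\{|z|=r\}\subset\sigma(S)$,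 $r\ge0$, it is (up to equality almost everywhere) the essentially bounded function whose Fourier coefficients $\int_0^1\widetilde M(re^{2\pi it})e^{-2\pi int}\,dt$ are $\widehat M(n)r^n$. Denote by $\widetilde M(\sigma(S))$ the essential range of $\widetilde M$ on $\sigma(S)$, that is, the union over all $r\ge0$ with $C_r\subset\sigma(S)$ of the essential ranges of $\widetilde M|_{C_r}$ with respect to arc length (for $r=0$, the value at the point $0$). 1) Every multiplier $M$ has a symbol in this sense, and $\overline{\widetilde M(\sigma(S))}\subset\sigma(M)$. 2) Let $\mathfrak S$ be the closure in operator norm of the algebra generated by the bounded operators $M_\phi$ on $E$ of convolution by $\phi$, $\phi\in F(\mathbb Z)$. If $\sigma(S)\neq\emptyset$, then every $M\in\mathfrak S$ is a multiplier and $\sigma(M)=\overline{\widetilde M(\sigma(S))}$. -/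

import Mathlib

open MeasureTheory Topology

noncomputable section

/-- The shift on all complex sequences on `ℤ`: `(S x)(n) = x(n - 1)`. -/
def seqShift : (ℤ → ℂ) →ₗ[ℂ] (ℤ → ℂ) := LinearMap.funLeft ℂ ℂ (fun n : ℤ => n - 1)

/-- The inverse of the shift: `(S⁻¹ x)(n) = x(n + 1)`. -/
def seqShiftInv : (ℤ → ℂ) →ₗ[ℂ] (ℤ → ℂ) := LinearMap.funLeft ℂ ℂ (fun n : ℤ => n + 1)

/-- The normed space `E` is a space of complex sequences on `ℤ` (through the injective linear map
`coord`) that contains all finitely supported sequences. -/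
structure SequenceSpace (E : Type*) [NormedAddCommGroup E] [NormedSpace ℂ E] where
  /-- the sequence that an element of `E` is -/
  coord : E →ₗ[ℂ] (ℤ → ℂ)
  coord_injective : Function.Injective coord
  finite_mem : ∀ a : ℤ → ℂ, a.support.Finite → ∃ x : E, coord x = a

namespace SequenceSpace

variable {E : Type*} [NormedAddCommGroup E] [NormedSpace ℂ E] (X : SequenceSpace E)

/-- The subspace `F(ℤ)` of `E` of the finitely supported sequences. -/
def finiteSeq : Submodule ℂ E where
  carrier := {x | (X.coord x).support.Finite}
  zero_mem' := by simp
  add_mem' := by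
    intro x y hx hy
    simp only [Set.mem_ofPred_eq, map_add] at *
    exact (hx.union hy).subset (Function.support_add _ _)
  smul_mem' := by
    intro c x hx
    simp only [Set.mem_ofPred_eq, map_smul] at *
    exact hx.subset (Function.support_const_smul_subset _ _)

/-- (H1): the finitely supported sequences are dense in `E`. -/
def H1 : Prop := Dense (X.finiteSeq : Set E)

/-- (H2): all coordinates `x ↦ x(n)` are continuous on `E`. -/
def H2 : Prop := ∀ n : ℤ, Continuous fun x : E => X.coord x n

/-- (H3): for `|z| = 1` the map `ψ_z : (x(n)) ↦ (x(n) z ^ n)` sends `E` to `E`, and the norms of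
these maps are bounded uniformly in `z`. -/
def H3 : Prop :=
  (∀ z : ℂ, ‖z‖ = 1 → ∀ x : E, ∃ y : E, X.coord y = fun n => X.coord x n * z ^ n) ∧
  ∃ C : ℝ, ∀ z : ℂ, ‖z‖ = 1 → ∀ x y : E,
    (X.coord y = fun n => X.coord x n * z ^ n) → ‖y‖ ≤ C * ‖x‖

/-- `S` is bounded on `E`: `S(E) ⊆ E`. -/
def ShiftBounded : Prop := ∀ x : E, ∃ y : E, X.coord y = seqShift (X.coord x)

/-- `S⁻¹` is bounded on `E`: `S⁻¹(E) ⊆ E`. -/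
def ShiftInvBounded : Prop := ∀ x : E, ∃ y : E, X.coord y = seqShiftInv (X.coord x)

/-- The shift as an operator in `E` with the domain `{x ∈ E | S x ∈ E}`. -/
def shift : E →ₗ.[ℂ] E where
  domain := (LinearMap.range X.coord).comap (seqShift ∘ₗ X.coord)
  toFun := (LinearEquiv.ofInjective X.coord X.coord_injective).symm.toLinearMap ∘ₗ
    LinearMap.restrict (seqShift ∘ₗ X.coord) (fun _ hx => hx)

theorem coord_shift (x : X.shift.domain) : X.coord (X.shift x) = seqShift (X.coord x) :=
  congrArg Subtype.val ((LinearEquiv.ofInjective X.coord X.coord_injective).apply_symm_apply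
    ⟨seqShift (X.coord x), x.2⟩)

/-- The restriction of the shift to the finitely supported sequences. -/
def shiftFinite : E →ₗ.[ℂ] E := X.shift.domRestrict X.finiteSeq

open Classical in
/-- The operator whose spectrum is `σ(S)`: `S` with domain `E` if `S(E) ⊆ E`, and the smallest
closed extension of the restriction of `S` to the finitely supported sequences otherwise. -/
def shiftOperator : E →ₗ.[ℂ] E :=
  if X.ShiftBounded then X.shift else X.shiftFinite.closure

end SequenceSpace

/-- The spectrum of a (possibly unbounded) operator `T`: the `z` for which `T - z` has no bounded
everywhere defined two-sided inverse. -/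
def operatorSpectrum {E : Type*} [NormedAddCommGroup E] [NormedSpace ℂ E] (T : E →ₗ.[ℂ] E) :
    Set ℂ :=
  {z | ¬ ∃ R : E →L[ℂ] E, (∀ x : T.domain, R (T x - z • (x : E)) = x) ∧
      ∀ y : E, ∃ h : R y ∈ T.domain, T ⟨R y, h⟩ - z • R y = y}

namespace SequenceSpace

variable {E : Type*} [NormedAddCommGroup E] [NormedSpace ℂ E] (X : SequenceSpace E)

/-- `σ(S)`. -/
def shiftSpectrum : Set ℂ := operatorSpectrum X.shiftOperator

/-- Multipliers: bounded operators `M` on `E` with `M S a = S M a` for all finitely supported `a`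
(here `b = S a`, and `S M a` is computed in the space of all sequences). -/
def IsMultiplier (M : E →L[ℂ] E) : Prop :=
  ∀ a b : E, a ∈ X.finiteSeq → X.coord b = seqShift (X.coord a) →
    X.coord (M b) = seqShift (X.coord (M a))

/-- The sequence `e_0`, as an element of `E`. -/
def e0 : E := Classical.choose (X.finite_mem (Pi.single 0 1)
  ((Set.finite_singleton (0 : ℤ)).subset Pi.support_single_subset))

/-- The sequence `M̂ = M e_0`. -/
def symbolCoeff (M : E →L[ℂ] E) : ℤ → ℂ := X.coord (M X.e0)

end SequenceSpace

/-- The function `t ↦ g (r e^{2 π i t})` on `ℝ / ℤ`: the restriction of `g` to the circle `C_r` with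
centre `0` and radius `r`. -/
def onCircle (g : ℂ → ℂ) (r : ℝ) : UnitAddCircle → ℂ :=
  fun t => g ((r : ℂ) * (AddCircle.toCircle t : ℂ))

/-- The essential range of a function. -/
def essentialRange {α : Type*} [MeasurableSpace α] (μ : Measure α) (f : α → ℂ) : Set ℂ :=
  {w | ∀ U ∈ 𝓝 w, μ (f ⁻¹' U) ≠ 0}

/-- The essential range of `g` on a set `A ⊆ ℂ` that is a union of circles with centre `0`: the
union of the essential ranges of `g` on these circles, with respect to arc length (for `r = 0` the
circle is the point `0`, with a unit mass). On a circle on which `g` is continuous, as in the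
interior of `A` where `g` is holomorphic, this is the set of all values of `g`. -/
def circularEssRange (g : ℂ → ℂ) (A : Set ℂ) : Set ℂ :=
  {w | ∃ r : ℝ, 0 ≤ r ∧ Metric.sphere (0 : ℂ) r ⊆ A ∧
    w ∈ essentialRange AddCircle.haarAddCircle (onCircle g r)}

namespace SequenceSpace

variable {E : Type*} [NormedAddCommGroup E] [NormedSpace ℂ E] (X : SequenceSpace E)

/-- `g` is the symbol `M̃(z) = ∑ M̂(n) z ^ n` of `M` on `σ(S)`: the series converges to `g` at every
point of the interior of `σ(S)`, and on each circle `C_r ⊆ σ(S)` the function `g` is essentially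
bounded, with Fourier series `∑ M̂(n) r ^ n e^{2 π i n t}`. This determines `g` everywhere in the
interior of `σ(S)` and almost everywhere on each of these circles. -/
def IsSymbol (M : E →L[ℂ] E) (g : ℂ → ℂ) : Prop :=
  (∀ z ∈ interior X.shiftSpectrum, HasSum (fun n : ℤ => X.symbolCoeff M n * z ^ n) (g z)) ∧
  ∀ r : ℝ, 0 ≤ r → Metric.sphere (0 : ℂ) r ⊆ X.shiftSpectrum →
    MemLp (onCircle g r) ⊤ AddCircle.haarAddCircle ∧
    ∀ n : ℤ, fourierCoeff (onCircle g r) n = X.symbolCoeff M n * (r : ℂ) ^ n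

/-- `T` is the operator `M_φ` of convolution by the finitely supported sequence `φ`:
`(T x)(n) = ∑_k φ(k) x(n - k)`. -/
def IsConvolution (φ : ℤ →₀ ℂ) (T : E →L[ℂ] E) : Prop :=
  ∀ (x : E) (n : ℤ), X.coord (T x) n = φ.sum fun k c => c * X.coord x (n - k)

/-- The algebra `𝔖`: the operator norm closure of the algebra generated by the (bounded) operators
`M_φ` with `φ` finitely supported. -/
def convolutionAlgebra : Subalgebra ℂ (E →L[ℂ] E) :=
  (Algebra.adjoin ℂ {T | ∃ φ : ℤ →₀ ℂ, X.IsConvolution φ T}).topologicalClosure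

end SequenceSpace

end

open MeasureTheory Topology

/-! Conjugating a multiplier `M` by the rotation `ψ_z` multiplies its coefficient `M̂(n)` by `z ^
n`. Averaging these conjugates with Fejér weights replaces `M` by convolutions with finitely
supported `φ_k`, of norm at most `K * ‖M‖` (`exists_isConvolution_cesaroCoeff`). If `T` is a bounded
convolution by `φ`, then `S ^ m * T` is a polynomial in `S` for large `m`, and pure algebra gives
`φ(w) ∈ σ(T)` for `w ∈ σ(S)` (`IsShift.sum_mem_spectrum`). Hence `|φ_k| ≤ K * ‖M‖` on `σ(S)`.
Uniformly bounded Fejér means on a circle come from an essentially bounded function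
(`exists_Lp_fourierCoeff_eq`): this is the symbol, and it inherits the bound.

Symbols are multiplicative (`IsSymbolDomain.fourierCoeff_mul`). If `M - l` is invertible, its
inverse is again a multiplier; its symbol is bounded by one constant on all circles, so `M̃` stays
uniformly away from `l`. This is the inclusion in 1).

For the converse inclusion on `𝔖`, a point `l ∈ σ(M)` is the value `γ(M)` of a character of the
commutative Banach algebra `𝔖`. The moduli of the points of `σ(S)` form an interval
(`IsShift.mem_spectrum_of_norm_le`): in a gap, the coefficients of the resolvent would satisfy a
recurrence incompatible with the symbol bounds on both sides. Therefore `γ(S) ∈ σ(S)`, and `γ`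
evaluates the symbols of convolutions at `γ(S)`. Approximating `M` by a convolution, whose symbol is
continuous on circles, shows that `M̃` is close to `l` on a set of positive measure.

When only `S⁻¹` is bounded, reversing the order of `ℤ` makes it a bounded shift, and `σ(S)` is the
set of inverses of the nonzero points of its spectrum. The lost point `0` is recovered by
approximation, which needs `σ(S) ≠ ∅`. -/

noncomputable section

/-! ### Fejér weights -/

/-- The coefficients `(1 - |n| / (k + 1))₊` of the Fejér kernel. -/
def fejer (k : ℕ) (n : ℤ) : ℝ := ((k + 1 - |n|).toNat : ℝ) / (k + 1)

theorem fejer_nonneg (k : ℕ) (n : ℤ) : 0 ≤ fejer k n := by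
  unfold fejer; positivity

theorem fejer_le_one (k : ℕ) (n : ℤ) : fejer k n ≤ 1 := by
  unfold fejer
  rw [div_le_one (by positivity)]
  have : (k + 1 - |n|).toNat ≤ k + 1 := by
    have := abs_nonneg n
    omega
  exact_mod_cast this

theorem fejer_zero (k : ℕ) : fejer k 0 = 1 := by
  unfold fejer
  have : ((k : ℤ) + 1 - |0|).toNat = k + 1 := by simp
  rw [this]; push_cast
  exact div_self (by positivity)

theorem fejer_eq_zero {k : ℕ} {n : ℤ} (h : n ∉ Finset.Icc (-(k : ℤ)) k) : fejer k n = 0 := by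
  unfold fejer
  have : ((k : ℤ) + 1 - |n|).toNat = 0 := by
    simp only [Finset.mem_Icc, not_and_or, not_le] at h
    have := le_abs_self n
    have := neg_le_abs n
    omega
  rw [this]; simp

theorem tendsto_fejer (n : ℤ) : Filter.Tendsto (fun k => fejer k n) Filter.atTop (𝓝 1) := by
  have h : Filter.Tendsto (fun k : ℕ => 1 - (|n| : ℝ) * (1 / ((k : ℝ) + 1))) Filter.atTop (𝓝 1) := by
    simpa using (tendsto_one_div_add_atTop_nhds_zero_nat (𝕜 := ℝ)).const_mul (|n| : ℝ) |>.const_sub 1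
  refine tendsto_of_tendsto_of_tendsto_of_le_of_le h tendsto_const_nhds ?_ (fun k => fejer_le_one k n)
  intro k
  simp only [fejer]
  rw [le_div_iff₀ (by positivity)]
  have h1 : ((k : ℤ) + 1 - |n|) ≤ ((k + 1 - |n|).toNat : ℤ) := Int.self_le_toNat _
  have h2 : ((k : ℝ) + 1 - |(n : ℝ)|) ≤ ((k + 1 - |n|).toNat : ℝ) := by exact_mod_cast h1
  have : ((k : ℝ) + 1) ≠ 0 := by positivity
  field_simp
  linarith

theorem sum_zpow_rootOfUnity {N : ℕ} (_hN : 0 < N) {ω : ℂ} (hω : IsPrimitiveRoot ω N) (l : ℤ) :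
    ∑ j ∈ Finset.range N, (ω ^ j) ^ l = if (N : ℤ) ∣ l then (N : ℂ) else 0 := by
  have h : ∀ j : ℕ, (ω ^ j) ^ l = (ω ^ l) ^ j := fun j => by
    rw [← zpow_natCast, ← zpow_natCast, ← zpow_mul, ← zpow_mul, mul_comm]
  simp only [h]
  split_ifs with hd
  · rw [(hω.zpow_eq_one_iff_dvd l).2 hd]; simp
  · have h1 : ω ^ l ≠ 1 := fun h => hd ((hω.zpow_eq_one_iff_dvd l).1 h)
    have h2 : (ω ^ l) ^ N = 1 := by
      rw [← h, hω.pow_eq_one, one_zpow]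
    rw [geom_sum_eq h1, h2]; simp

/-- The Fejér weights are, on any finite window, the moments of a discrete probability measure on
the unit circle. -/
theorem exists_fejer_moments (k m : ℕ) : ∃ (N : ℕ) (μ : ℕ → ℝ) (z : ℕ → ℂ), (∀ j, 0 ≤ μ j) ∧
    (∑ j ∈ Finset.range N, μ j = 1) ∧ (∀ j, ‖z j‖ = 1) ∧
    ∀ n : ℤ, |n| ≤ m → ∑ j ∈ Finset.range N, (μ j : ℂ) * z j ^ n = fejer k n := by
  -- The exponents `a - b + n` below satisfy `|a - b| ≤ k` and `|n| ≤ m`; with `N > k + m` the only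
  -- multiple of `N` among them is `0`, so sampling at `N`-th roots of unity causes no aliasing.
  set N : ℕ := k + m + 1 with hN
  set ω : ℂ := Complex.exp (2 * Real.pi * Complex.I / N) with hω
  have hp : IsPrimitiveRoot ω N := Complex.isPrimitiveRoot_exp N (by omega)
  have hn : ∀ j : ℕ, ‖ω ^ j‖ = 1 := fun j => by
    rw [norm_pow, hp.norm'_eq_one (by omega), one_pow]
  set I : Finset ℤ := Finset.Ico 0 ((k : ℤ) + 1) with hI
  -- The Fejér kernel, a normalized squared modulus of a geometric sum, sampled at the roots of
  -- unity; the square makes the weights nonnegative.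
  set μ : ℕ → ℝ := fun j => ‖∑ a ∈ I, (ω ^ j) ^ a‖ ^ 2 / (N * (k + 1)) with hμ
  have hmom : ∀ n : ℤ, |n| ≤ m → ∑ j ∈ Finset.range N, (μ j : ℂ) * (ω ^ j) ^ n = fejer k n := by
    intro n hnm
    have h1 : ∀ j : ℕ, (μ j : ℂ) * (ω ^ j) ^ n =
        (∑ a ∈ I, ∑ b ∈ I, (ω ^ j) ^ (a - b + n)) / (N * (k + 1)) := by
      intro j
      have h0 : ω ^ j ≠ 0 := by
        intro h; have := hn j; rw [h] at this; simp at this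
      have hc : (starRingEnd ℂ) (ω ^ j) = (ω ^ j)⁻¹ := by
        rw [Complex.inv_def, Complex.normSq_eq_norm_sq, hn j]; simp
      have h2 : ((‖∑ a ∈ I, (ω ^ j) ^ a‖ ^ 2 : ℝ) : ℂ) =
          (∑ a ∈ I, (ω ^ j) ^ a) * ∑ b ∈ I, (ω ^ j) ^ (-b) := by
        rw [← Complex.normSq_eq_norm_sq, ← Complex.mul_conj, map_sum]
        congr 1
        refine Finset.sum_congr rfl fun b _ => ?_
        rw [map_zpow₀, hc, inv_zpow, zpow_neg]
      simp only [hμ]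
      rw [Complex.ofReal_div, h2, Finset.sum_mul_sum]
      push_cast
      rw [div_mul_eq_mul_div, Finset.sum_mul]
      congr 1
      refine Finset.sum_congr rfl fun a _ => ?_
      rw [Finset.sum_mul]
      refine Finset.sum_congr rfl fun b _ => ?_
      rw [sub_eq_add_neg, zpow_add₀ h0, zpow_add₀ h0]
    simp only [h1]
    rw [← Finset.sum_div, Finset.sum_comm]
    have h3 : ∀ a ∈ I, ∑ j ∈ Finset.range N, ∑ b ∈ I, (ω ^ j) ^ (a - b + n) =
        if a + n ∈ I then (N : ℂ) else 0 := by
      intro a ha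
      rw [Finset.sum_comm]
      have : ∀ b ∈ I, ∑ j ∈ Finset.range N, (ω ^ j) ^ (a - b + n) =
          if a + n = b then (N : ℂ) else 0 := by
        intro b hb
        rw [sum_zpow_rootOfUnity (by omega) hp]
        have : (N : ℤ) ∣ a - b + n ↔ a + n = b := by
          simp only [hI, Finset.mem_Ico] at ha hb
          constructor
          · intro hd
            have := Int.eq_zero_of_abs_lt_dvd hd (by
              have := abs_le.1 hnm
              rw [abs_lt]; push_cast [hN]; omega)
            omega
          · intro h; have : a - b + n = 0 := by omega
            rw [this]; exact dvd_zero _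
        simp only [this]
      rw [Finset.sum_congr rfl this, Finset.sum_ite_eq]
    rw [Finset.sum_congr rfl h3, ← Finset.sum_filter, Finset.sum_const, nsmul_eq_mul]
    have h4 : (I.filter fun a => a + n ∈ I).card = ((k : ℤ) + 1 - |n|).toNat := by
      have : (I.filter fun a => a + n ∈ I) =
          Finset.Ico (max 0 (-n)) (min ((k : ℤ) + 1) (k + 1 - n)) := by
        ext a
        simp only [hI, Finset.mem_filter, Finset.mem_Ico]
        omega
      rw [this, Int.card_Ico]
      congr 1
      rcases abs_cases n with h | h <;> omega
    rw [h4, fejer]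
    push_cast
    have : (N : ℂ) ≠ 0 := by exact_mod_cast (by omega : N ≠ 0)
    have : ((k : ℂ) + 1) ≠ 0 := by exact_mod_cast (by omega : k + 1 ≠ 0)
    field_simp
  refine ⟨N, μ, fun j => ω ^ j, fun j => by positivity, ?_, hn, hmom⟩
  have := hmom 0 (by simp)
  simp only [zpow_zero, mul_one, fejer_zero] at this
  exact_mod_cast this

/-! ### Finitely supported sequences, rotations and Cesàro means -/

namespace SequenceSpace

variable {E : Type*} [NormedAddCommGroup E] [NormedSpace ℂ E] (X : SequenceSpace E)

/-- The sequence `e_n`, as an element of `E`. -/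
def basisSeq (n : ℤ) : E := Classical.choose (X.finite_mem (Pi.single n 1)
  ((Set.finite_singleton n).subset Pi.support_single_subset))

theorem coord_basisSeq (n : ℤ) : X.coord (X.basisSeq n) = Pi.single n 1 :=
  Classical.choose_spec (X.finite_mem (Pi.single n 1)
    ((Set.finite_singleton n).subset Pi.support_single_subset))

theorem coord_basisSeq_apply (n m : ℤ) : X.coord (X.basisSeq n) m = if m = n then 1 else 0 := by
  rw [coord_basisSeq, Pi.single_apply]

theorem e0_eq_basisSeq : X.e0 = X.basisSeq 0 := rfl

theorem coord_e0_apply (m : ℤ) : X.coord X.e0 m = if m = 0 then 1 else 0 :=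
  X.coord_basisSeq_apply 0 m

theorem basisSeq_mem (n : ℤ) : X.basisSeq n ∈ X.finiteSeq := by
  change (X.coord (X.basisSeq n)).support.Finite
  rw [coord_basisSeq]
  exact (Set.finite_singleton n).subset Pi.support_single_subset

theorem e0_mem : X.e0 ∈ X.finiteSeq := X.basisSeq_mem 0

theorem e0_ne_zero : X.e0 ≠ 0 := by
  intro h
  have := X.coord_e0_apply 0
  rw [h] at this; simp at this

theorem coord_sum_basisSeq (s : Finset ℤ) (c : ℤ → ℂ) (n : ℤ) :
    X.coord (∑ p ∈ s, c p • X.basisSeq p) n = if n ∈ s then c n else 0 := by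
  simp only [map_sum, map_smul, Finset.sum_apply, Pi.smul_apply, coord_basisSeq_apply, smul_eq_mul,
    mul_ite, mul_one, mul_zero, Finset.sum_ite_eq]

variable {X}

theorem coord_ext {x y : E} (h : ∀ n, X.coord x n = X.coord y n) : x = y :=
  X.coord_injective (funext h)

/-- A finitely supported sequence vanishes outside a symmetric window. -/
theorem exists_window {x : E} (hx : x ∈ X.finiteSeq) :
    ∃ m : ℕ, ∀ n : ℤ, (m : ℤ) < |n| → X.coord x n = 0 := by
  obtain ⟨s, hs⟩ := Set.Finite.exists_finset_coe (show (X.coord x).support.Finite from hx)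
  refine ⟨s.sup Int.natAbs, fun n hn => ?_⟩
  by_contra h
  have h1 : n ∈ s := by
    rw [← Finset.mem_coe, hs]; exact h
  have := Finset.le_sup (f := Int.natAbs) h1
  rw [Int.abs_eq_natAbs] at hn
  omega

theorem eq_sum_basisSeq {x : E} {s : Finset ℤ} (hs : ∀ n, n ∉ s → X.coord x n = 0) :
    x = ∑ p ∈ s, X.coord x p • X.basisSeq p := by
  refine coord_ext (X := X) fun n => ?_
  rw [coord_sum_basisSeq]
  split_ifs with h
  · rfl
  · exact hs n h

theorem exists_eq_sum_basisSeq {x : E} (hx : x ∈ X.finiteSeq) :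
    ∃ s : Finset ℤ, (∀ n, n ∉ s → X.coord x n = 0) ∧ x = ∑ p ∈ s, X.coord x p • X.basisSeq p := by
  obtain ⟨s, hs⟩ := Set.Finite.exists_finset_coe (show (X.coord x).support.Finite from hx)
  have : ∀ n, n ∉ s → X.coord x n = 0 := fun n hn => by
    by_contra h
    exact hn (by rw [← Finset.mem_coe, hs]; exact h)
  exact ⟨s, this, eq_sum_basisSeq this⟩

/-- Closed conditions that hold for finitely supported sequences hold on `E`. -/
theorem H1.induction (h1 : X.H1) {p : E → Prop} (hp : IsClosed {x | p x})
    (h : ∀ x ∈ X.finiteSeq, p x) (x : E) : p x := by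
  have : closure (X.finiteSeq : Set E) ⊆ {x | p x} := closure_minimal h hp
  exact this (h1 x)

variable (X) in
/-- The Cesàro means of a sequence. -/
def cesaro (k : ℕ) (x : E) : E :=
  ∑ n ∈ Finset.Icc (-(k : ℤ)) k, ((fejer k n : ℂ) * X.coord x n) • X.basisSeq n

theorem coord_cesaro (k : ℕ) (x : E) (n : ℤ) :
    X.coord (X.cesaro k x) n = fejer k n * X.coord x n := by
  rw [cesaro, coord_sum_basisSeq]
  split_ifs with h
  · rfl
  · rw [fejer_eq_zero h]; simp

theorem H2.continuous_cesaro (h2 : X.H2) (k : ℕ) : Continuous (X.cesaro k) :=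
  continuous_finsetSum _ fun n _ => ((h2 n).const_mul _).smul continuous_const

theorem cesaro_sub (k : ℕ) (x y : E) : X.cesaro k (x - y) = X.cesaro k x - X.cesaro k y := by
  refine coord_ext (X := X) fun n => ?_
  simp only [coord_cesaro, map_sub, Pi.sub_apply, mul_sub]

theorem tendsto_cesaro_of_mem {x : E} (hx : x ∈ X.finiteSeq) :
    Filter.Tendsto (fun k => X.cesaro k x) Filter.atTop (𝓝 x) := by
  obtain ⟨s, hs, hsum⟩ := exists_eq_sum_basisSeq hx
  have h : ∀ k, X.cesaro k x = ∑ p ∈ s, ((fejer k p : ℂ) * X.coord x p) • X.basisSeq p := fun k => by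
    refine coord_ext (X := X) fun n => ?_
    rw [coord_cesaro, coord_sum_basisSeq]
    split_ifs with h
    · rfl
    · rw [hs n h, mul_zero]
  simp only [h]
  conv => enter [3, 1]; rw [hsum]
  refine tendsto_finsetSum _ fun p _ => Filter.Tendsto.smul_const ?_ _
  have : Filter.Tendsto (fun k => (fejer k p : ℂ)) Filter.atTop (𝓝 ((1 : ℝ) : ℂ)) :=
    (Complex.continuous_ofReal.tendsto _).comp (tendsto_fejer p)
  simpa using this.mul_const (X.coord x p)

/-- (H3) in the form in which it is used: rotations with a common norm bound, and the resulting
bound for the Cesàro means. -/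
theorem exists_rotation (h1 : X.H1) (h2 : X.H2) (h3 : X.H3) : ∃ (ψ : ℂ → E → E) (C : ℝ), 0 ≤ C ∧
    (∀ z : ℂ, ‖z‖ = 1 → ∀ x n, X.coord (ψ z x) n = X.coord x n * z ^ n) ∧
    (∀ z : ℂ, ‖z‖ = 1 → ∀ x, ‖ψ z x‖ ≤ C * ‖x‖) ∧
    ∀ k x, ‖X.cesaro k x‖ ≤ C * ‖x‖ := by
  obtain ⟨hψ, C, hC⟩ := h3
  choose! ψ hψ using hψ
  have hn : ∀ z : ℂ, ‖z‖ = 1 → ∀ x, ‖ψ z x‖ ≤ C * ‖x‖ := fun z hz x => hC z hz x _ (hψ z hz x)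
  have hC0 : 0 ≤ C := by
    have h := (norm_nonneg _).trans (hn 1 (by simp) X.e0)
    exact nonneg_of_mul_nonneg_left h (norm_pos_iff.2 X.e0_ne_zero)
  refine ⟨ψ, C, hC0, fun z hz x n => by rw [hψ z hz x], hn, fun k => ?_⟩
  refine h1.induction (isClosed_le (h2.continuous_cesaro k).norm
    (continuous_const.mul continuous_norm)) fun x hx => ?_
  obtain ⟨m, hm⟩ := exists_window hx
  obtain ⟨N, μ, z, hμ0, hμ1, hz, hmom⟩ := exists_fejer_moments k m
  -- A Cesàro mean is a convex combination of rotations. The moment identity is valid only for `|n|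
  -- ≤ m`, but `x` vanishes outside this window.
  have : X.cesaro k x = ∑ j ∈ Finset.range N, (μ j : ℂ) • ψ (z j) x := by
    refine coord_ext (X := X) fun n => ?_
    simp only [coord_cesaro, map_sum, map_smul, Finset.sum_apply, Pi.smul_apply, smul_eq_mul]
    by_cases h : |n| ≤ m
    · rw [← hmom n h, Finset.sum_mul]
      refine Finset.sum_congr rfl fun j _ => ?_
      rw [hψ _ (hz j) x]; ring
    · rw [hm n (by omega), mul_zero, Finset.sum_eq_zero]
      intro j _
      simp only [hψ _ (hz j) x, hm n (by omega)]; ring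
  rw [this]
  calc ‖∑ j ∈ Finset.range N, (μ j : ℂ) • ψ (z j) x‖
      ≤ ∑ j ∈ Finset.range N, μ j * (C * ‖x‖) := by
        refine norm_sum_le_of_le _ fun j _ => ?_
        rw [norm_smul, Complex.norm_real, Real.norm_of_nonneg (hμ0 j)]
        exact mul_le_mul_of_nonneg_left (hn _ (hz j) x) (hμ0 j)
    _ = C * ‖x‖ := by rw [← Finset.sum_mul, hμ1, one_mul]

/-- Convergence on the dense subspace of finitely supported sequences extends to `E` because the
Cesàro means are uniformly bounded. -/
theorem tendsto_cesaro (h1 : X.H1) (h2 : X.H2) (h3 : X.H3) (x : E) :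
    Filter.Tendsto (fun k => X.cesaro k x) Filter.atTop (𝓝 x) := by
  obtain ⟨ψ, C, hC0, -, -, hC⟩ := exists_rotation h1 h2 h3
  rw [Metric.tendsto_atTop]
  intro ε hε
  have hδ : 0 < ε / (C + 2) := by positivity
  obtain ⟨y, hy, hxy⟩ := Metric.mem_closure_iff.1 (h1 x) _ hδ
  obtain ⟨K, hK⟩ := Metric.tendsto_atTop.1 (tendsto_cesaro_of_mem hy) _ hδ
  refine ⟨K, fun k hk => ?_⟩
  have h := hK k hk
  rw [dist_eq_norm] at h hxy ⊢
  have e : X.cesaro k x - x = X.cesaro k (x - y) + (X.cesaro k y - y) - (x - y) := by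
    rw [cesaro_sub]; abel
  rw [e]
  calc _ ≤ ‖X.cesaro k (x - y)‖ + ‖X.cesaro k y - y‖ + ‖x - y‖ :=
        (norm_sub_le _ _).trans (add_le_add_left (norm_add_le _ _) _)
    _ < C * (ε / (C + 2)) + ε / (C + 2) + ε / (C + 2) := by
        have := (hC k (x - y)).trans (mul_le_mul_of_nonneg_left hxy.le hC0)
        linarith
    _ = ε := by field_simp; ring

/-! ### Multipliers and convolutions -/

theorem seqShift_apply (x : ℤ → ℂ) (n : ℤ) : seqShift x n = x (n - 1) := rfl

theorem seqShiftInv_apply (x : ℤ → ℂ) (n : ℤ) : seqShiftInv x n = x (n + 1) := rfl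

theorem seqShift_basisSeq (p : ℤ) :
    X.coord (X.basisSeq (p + 1)) = seqShift (X.coord (X.basisSeq p)) := by
  ext n
  simp only [seqShift_apply, coord_basisSeq_apply, sub_eq_iff_eq_add]

/-- Commutation with the shift is used in both directions along `ℤ`, without inverting `S`. As a
result `M` acts on finitely supported sequences as convolution by `M̂`. -/
theorem IsMultiplier.coord_basisSeq {M : E →L[ℂ] E} (hM : X.IsMultiplier M) (p n : ℤ) :
    X.coord (M (X.basisSeq p)) n = X.symbolCoeff M (n - p) := by
  have step : ∀ p n : ℤ, X.coord (M (X.basisSeq (p + 1))) n = X.coord (M (X.basisSeq p)) (n - 1) :=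
    fun p n => by
      rw [hM _ _ (X.basisSeq_mem p) (seqShift_basisSeq p), seqShift_apply]
  induction p generalizing n with
  | zero => simp [symbolCoeff, e0_eq_basisSeq]
  | succ i ih => rw [step, ih]; congr 1; ring
  | pred i ih =>
    have := step (-(i : ℤ) - 1) (n + 1)
    rw [sub_add_cancel, ih, add_sub_cancel_right] at this
    rw [← this]; congr 1; ring

theorem IsMultiplier.coord_apply {M : E →L[ℂ] E} (hM : X.IsMultiplier M) {x : E} {s : Finset ℤ}
    (hs : ∀ n, n ∉ s → X.coord x n = 0) (n : ℤ) :
    X.coord (M x) n = ∑ p ∈ s, X.coord x p * X.symbolCoeff M (n - p) := by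
  conv_lhs => rw [eq_sum_basisSeq hs]
  simp only [map_sum, map_smul, Finset.sum_apply, Pi.smul_apply, smul_eq_mul, hM.coord_basisSeq]

theorem finsupp_sum_eq (φ : ℤ →₀ ℂ) {a : ℤ → ℂ} {s : Finset ℤ} (hs : ∀ n, n ∉ s → a n = 0)
    (n : ℤ) : (φ.sum fun k c => c * a (n - k)) = ∑ p ∈ s, a p * φ (n - p) := by
  rw [Finsupp.sum, ← Finset.sum_filter_ne_zero, ← Finset.sum_filter_ne_zero (s := s)]
  refine Finset.sum_bij' (fun k _ => n - k) (fun p _ => n - p) ?_ ?_ ?_ ?_ ?_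
  · intro k hk
    simp only [Finset.mem_filter] at hk ⊢
    refine ⟨?_, ?_⟩
    · by_contra h; exact hk.2 (by rw [hs _ h, mul_zero])
    · rw [sub_sub_cancel, mul_comm]; exact hk.2
  · intro p hp
    simp only [Finset.mem_filter] at hp ⊢
    refine ⟨?_, ?_⟩
    · rw [Finsupp.mem_support_iff]; exact right_ne_zero_of_mul hp.2
    · rw [sub_sub_cancel, mul_comm]; exact hp.2
  · intro k _; exact sub_sub_cancel _ _
  · intro k _; exact sub_sub_cancel _ _
  · intro k _; simp only [sub_sub_cancel]; ring

theorem IsConvolution.isMultiplier {φ : ℤ →₀ ℂ} {T : E →L[ℂ] E} (hT : X.IsConvolution φ T) :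
    X.IsMultiplier T := by
  intro a b _ hb
  ext n
  rw [seqShift_apply, hT, hT, hb]
  simp only [seqShift_apply]
  refine Finsupp.sum_congr fun k _ => ?_
  rw [sub_right_comm]

theorem IsConvolution.symbolCoeff {φ : ℤ →₀ ℂ} {T : E →L[ℂ] E} (hT : X.IsConvolution φ T) (n : ℤ) :
    X.symbolCoeff T n = φ n := by
  rw [SequenceSpace.symbolCoeff, hT, finsupp_sum_eq φ (s := {0})]
  · simp [coord_e0_apply]
  · intro n hn
    rw [coord_e0_apply, if_neg (by simpa using hn)]

theorem H2.continuous_convolution (h2 : X.H2) (φ : ℤ →₀ ℂ) (n : ℤ) :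
    Continuous fun x : E => φ.sum fun k c => c * X.coord x (n - k) :=
  continuous_finsetSum _ fun k _ => (h2 (n - k)).const_mul _

/-- A multiplier with finitely supported symbol coefficients is a convolution. -/
theorem IsMultiplier.isConvolution (h1 : X.H1) (h2 : X.H2) {M : E →L[ℂ] E} (hM : X.IsMultiplier M)
    {φ : ℤ →₀ ℂ} (hφ : ∀ n, X.symbolCoeff M n = φ n) : X.IsConvolution φ M := by
  intro x n
  revert x
  refine h1.induction (isClosed_eq ((h2 n).comp M.continuous) (h2.continuous_convolution φ n)) ?_
  intro x hx
  obtain ⟨s, hs, -⟩ := exists_eq_sum_basisSeq hx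
  rw [hM.coord_apply hs, finsupp_sum_eq φ hs]
  simp only [hφ]

/-- Convolution by `φ` on all sequences. -/
def seqConv (φ : ℤ →₀ ℂ) : (ℤ → ℂ) →ₗ[ℂ] (ℤ → ℂ) :=
  ∑ k ∈ φ.support, φ k • LinearMap.funLeft ℂ ℂ (fun n : ℤ => n - k)

theorem seqConv_apply (φ : ℤ →₀ ℂ) (a : ℤ → ℂ) (n : ℤ) :
    seqConv φ a n = φ.sum fun k c => c * a (n - k) := by
  simp [seqConv, Finsupp.sum, LinearMap.sum_apply, LinearMap.funLeft_apply]

theorem exists_coord_eq_seqConv (φ : ℤ →₀ ℂ) {a : E} (ha : a ∈ X.finiteSeq) :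
    ∃ b ∈ X.finiteSeq, X.coord b = seqConv φ (X.coord a) := by
  have hf : (seqConv φ (X.coord a)).support.Finite := by
    refine (φ.support.finite_toSet.add (show (X.coord a).support.Finite from ha)).subset ?_
    intro n hn
    rw [Function.mem_support, seqConv_apply] at hn
    obtain ⟨k, hk, hk'⟩ := Finset.exists_ne_zero_of_sum_ne_zero hn
    exact Set.mem_add.2 ⟨k, hk, n - k, right_ne_zero_of_mul hk', by ring⟩
  obtain ⟨b, hb⟩ := X.finite_mem _ hf
  refine ⟨b, ?_, hb⟩
  change (X.coord b).support.Finite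
  rwa [hb]

/-- Convolutions that are bounded on the finitely supported sequences extend to `E`. -/
theorem exists_isConvolution [CompleteSpace E] (h1 : X.H1) (h2 : X.H2) (φ : ℤ →₀ ℂ) {C : ℝ}
    (hC0 : 0 ≤ C)
    (hC : ∀ a ∈ X.finiteSeq, ∀ b ∈ X.finiteSeq,
      (∀ n, X.coord b n = φ.sum fun k c => c * X.coord a (n - k)) → ‖b‖ ≤ C * ‖a‖) :
    ∃ T : E →L[ℂ] E, X.IsConvolution φ T ∧ ‖T‖ ≤ C := by
  have hex : ∀ a : X.finiteSeq, ∃ b ∈ X.finiteSeq, X.coord b = seqConv φ (X.coord a) :=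
    fun a => exists_coord_eq_seqConv φ a.2
  choose f hf hfc using hex
  let L : X.finiteSeq →ₗ[ℂ] E :=
    { toFun := f
      map_add' := fun x y => X.coord_injective (by
        rw [map_add, hfc, hfc, hfc, Submodule.coe_add, map_add, map_add])
      map_smul' := fun c x => X.coord_injective (by
        rw [RingHom.id_apply, map_smul, hfc, hfc, Submodule.coe_smul, map_smul, map_smul]) }
  have hL : ∀ a, ‖L a‖ ≤ C * ‖a‖ := fun a => hC a a.2 (f a) (hf a) fun n => by
    rw [hfc, seqConv_apply]
  let L' : X.finiteSeq →L[ℂ] E := L.mkContinuous C hL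
  have hd : DenseRange (X.finiteSeq.subtypeL) := by
    have := h1.denseRange_val
    exact this
  have hi : IsUniformInducing (X.finiteSeq.subtypeL) := isUniformInducing_val _
  have hT : ∀ a : X.finiteSeq, L'.extend X.finiteSeq.subtypeL a = f a := fun a =>
    L'.extend_eq hd hi a
  refine ⟨L'.extend X.finiteSeq.subtypeL, ?_, ?_⟩
  · intro x n
    revert x
    refine h1.induction (isClosed_eq ((h2 n).comp (L'.extend X.finiteSeq.subtypeL).continuous)
      (h2.continuous_convolution φ n)) ?_
    intro x hx
    rw [hT ⟨x, hx⟩, hfc, seqConv_apply]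
  · refine ContinuousLinearMap.opNorm_le_bound _ hC0 ?_
    refine h1.induction (isClosed_le (L'.extend X.finiteSeq.subtypeL).continuous.norm
      (continuous_const.mul continuous_norm)) ?_
    intro x hx
    rw [hT ⟨x, hx⟩]
    exact hL ⟨x, hx⟩

variable (X) in
/-- The coefficients of the Cesàro means of the symbol of `M`. -/
def cesaroCoeff (M : E →L[ℂ] E) (k : ℕ) : ℤ →₀ ℂ :=
  Finsupp.onFinset (Finset.Icc (-(k : ℤ)) k) (fun n => (fejer k n : ℂ) * X.symbolCoeff M n)
    fun n hn => by
      by_contra h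
      exact hn (by rw [fejer_eq_zero h]; simp)

theorem cesaroCoeff_apply (M : E →L[ℂ] E) (k : ℕ) (n : ℤ) :
    X.cesaroCoeff M k n = fejer k n * X.symbolCoeff M n := rfl

/-- The Cesàro means of the symbol of a multiplier `M` are the symbols of bounded convolutions, with
norm at most a constant times `‖M‖`. -/
theorem exists_isConvolution_cesaroCoeff [CompleteSpace E] (h1 : X.H1) (h2 : X.H2) (h3 : X.H3) :
    ∃ K : ℝ, 0 ≤ K ∧ ∀ M : E →L[ℂ] E, X.IsMultiplier M → ∀ k,
      ∃ T : E →L[ℂ] E, X.IsConvolution (X.cesaroCoeff M k) T ∧ ‖T‖ ≤ K * ‖M‖ := by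
  obtain ⟨ψ, C, hC0, hψ, hψn, hC⟩ := exists_rotation h1 h2 h3
  -- One factor `C` for each of the rotations by `z` and `z⁻¹`, and one for the Cesàro mean between
  -- them.
  refine ⟨C * (C * C), by positivity, fun M hM k => ?_⟩
  refine exists_isConvolution h1 h2 _ (by positivity) fun a ha b hb hab => ?_
  obtain ⟨m, hm⟩ := exists_window ha
  have hs : ∀ n, n ∉ Finset.Icc (-(m : ℤ)) m → X.coord a n = 0 := fun n hn => hm n (by
    rw [Finset.mem_Icc, ← abs_le, not_le] at hn; exact hn)
  -- It suffices to bound the means `X.cesaro L b` uniformly in `L`. Passing to them cuts `M (ψ a)`,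
  -- which need not be finitely supported, down to the window `[-L, L]`; as `a` lives on `[-m, m]`,
  -- only moments of order at most `L + m` occur.
  refine le_of_tendsto (tendsto_cesaro_of_mem hb).norm (Filter.Eventually.of_forall fun L => ?_)
  obtain ⟨N, μ, z, hμ0, hμ1, hz, hmom⟩ := exists_fejer_moments k (L + m)
  have hz' : ∀ j, ‖(z j)⁻¹‖ = 1 := fun j => by rw [norm_inv, hz, inv_one]
  have hz0 : ∀ j, z j ≠ 0 := fun j h => by have := hz j; rw [h] at this; simp at this
  -- The factor `z ^ n * z ^ (-p)` produced by conjugation averages to the weight `fejer k (n - p)`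
  -- on `M̂(n - p)`.
  have : X.cesaro L b =
      ∑ j ∈ Finset.range N, (μ j : ℂ) • ψ (z j) (X.cesaro L (M (ψ (z j)⁻¹ a))) := by
    refine coord_ext (X := X) fun n => ?_
    simp only [coord_cesaro, map_sum, map_smul, Finset.sum_apply, Pi.smul_apply, smul_eq_mul,
      hψ _ (hz _)]
    by_cases hn : n ∈ Finset.Icc (-(L : ℤ)) L
    swap
    · rw [fejer_eq_zero hn]; simp
    rw [hab, finsupp_sum_eq _ hs]
    have hs' : ∀ j, ∀ n, n ∉ Finset.Icc (-(m : ℤ)) m → X.coord (ψ (z j)⁻¹ a) n = 0 :=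
      fun j n hn => by rw [hψ _ (hz' j), hs n hn, zero_mul]
    simp only [hM.coord_apply (hs' _), hψ _ (hz' _), Finset.mul_sum, Finset.sum_mul]
    rw [Finset.sum_comm]
    refine Finset.sum_congr rfl fun p hp => ?_
    have hnp : |n - p| ≤ (L + m : ℕ) := by
      rw [Finset.mem_Icc] at hn hp
      rw [abs_le]; push_cast; omega
    rw [cesaroCoeff_apply, ← hmom _ hnp, Finset.sum_mul, Finset.mul_sum, Finset.mul_sum]
    refine Finset.sum_congr rfl fun j _ => ?_
    rw [zpow_sub₀ (hz0 j), inv_zpow]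
    ring
  rw [this]
  calc _ ≤ ∑ j ∈ Finset.range N, μ j * (C * (C * C) * ‖M‖ * ‖a‖) := by
        refine norm_sum_le_of_le _ fun j _ => ?_
        rw [norm_smul, Complex.norm_real, Real.norm_of_nonneg (hμ0 j)]
        refine mul_le_mul_of_nonneg_left ?_ (hμ0 j)
        calc _ ≤ C * (C * (‖M‖ * (C * ‖a‖))) := by
              refine (hψn _ (hz j) _).trans (mul_le_mul_of_nonneg_left ?_ hC0)
              refine (hC _ _).trans (mul_le_mul_of_nonneg_left ?_ hC0)
              exact (M.le_opNorm _).trans (mul_le_mul_of_nonneg_left (hψn _ (hz' j) _)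
                (norm_nonneg _))
          _ = _ := by ring
    _ = _ := by rw [← Finset.sum_mul, hμ1, one_mul]

end SequenceSpace

/-! ### Fourier series on the circle -/

open AddCircle in
-- The Fejér means are bounded in `L²`, so Bessel's inequality puts `c` in `ℓ²`. The means then
-- converge in `L²` to the function with coefficients `c`, and an almost everywhere convergent
-- subsequence passes the bound `K` to the limit.
theorem exists_Lp_fourierCoeff_eq {c : ℤ → ℂ} {K : ℝ} (hK : 0 ≤ K)
    (h : ∀ (k : ℕ) (t : UnitAddCircle),
      ‖∑ n ∈ Finset.Icc (-(k : ℤ)) k, (fejer k n * c n) * fourier n t‖ ≤ K) :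
    ∃ G : UnitAddCircle → ℂ, MemLp G ⊤ haarAddCircle ∧ (∀ n, fourierCoeff G n = c n) ∧
      ∀ᵐ t ∂haarAddCircle, ‖G t‖ ≤ K := by
  set P : ℕ → C(UnitAddCircle, ℂ) := fun k =>
    ∑ n ∈ Finset.Icc (-(k : ℤ)) k, ((fejer k n : ℂ) * c n) • fourier n with hP
  have hPt : ∀ k t, P k t = ∑ n ∈ Finset.Icc (-(k : ℤ)) k, (fejer k n * c n) * fourier n t := by
    intro k t
    simp only [hP, ContinuousMap.coe_sum, Finset.sum_apply, ContinuousMap.coe_smul, Pi.smul_apply,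
      smul_eq_mul]
  have hPc : ∀ k n, fourierCoeff (P k) n = fejer k n * c n := by
    intro k n
    have e : (P k : UnitAddCircle → ℂ) = ∑ m ∈ Finset.Icc (-(k : ℤ)) k,
        (((fejer k m : ℂ) * c m) • (fourier m : UnitAddCircle → ℂ)) := by
      simp only [hP, ContinuousMap.coe_sum, ContinuousMap.coe_smul]
    rw [e, fourierCoeff.sum, Finset.sum_apply]
    · simp only [fourierCoeff.const_smul, fourierCoeff_fourier, Pi.single_apply, smul_eq_mul,
        mul_ite, mul_one, mul_zero, Finset.sum_ite_eq]
      split_ifs with hn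
      · rfl
      · rw [fejer_eq_zero hn]; simp
    · intro m _
      exact ((fourier m).continuous.integrable_of_hasCompactSupport
        (HasCompactSupport.of_compactSpace _)).smul _
  set F : ℕ → Lp ℂ 2 (haarAddCircle (T := 1)) := fun k => ContinuousMap.toLp 2 haarAddCircle ℂ (P k)
  have hFc : ∀ k n, fourierBasis.repr (F k) n = fejer k n * c n := fun k n => by
    rw [fourierBasis_repr, fourierCoeff_toLp, hPc]
  have hFae : ∀ k, F k =ᵐ[haarAddCircle] P k := fun k => ContinuousMap.coeFn_toLp _ _
  have hFb : ∀ k, ∀ᵐ t ∂haarAddCircle, ‖F k t‖ ≤ K := fun k => by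
    filter_upwards [hFae k] with t ht
    rw [ht, hPt]; exact h k t
  have hFn : ∀ k, ‖F k‖ ≤ K := fun k => by
    have := Lp.norm_le_of_ae_bound hK (hFb k)
    simpa [measureUnivNNReal] using this
  have hsum : ∀ s : Finset ℤ, ∑ n ∈ s, ‖c n‖ ^ 2 ≤ K ^ 2 := by
    intro s
    have hlim : Filter.Tendsto (fun k => ∑ n ∈ s, ‖(fejer k n : ℂ) * c n‖ ^ 2) Filter.atTop
        (𝓝 (∑ n ∈ s, ‖c n‖ ^ 2)) := by
      refine tendsto_finsetSum _ fun n _ => ?_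
      have : Filter.Tendsto (fun k => (fejer k n : ℂ)) Filter.atTop (𝓝 ((1 : ℝ) : ℂ)) :=
        (Complex.continuous_ofReal.tendsto _).comp (tendsto_fejer n)
      simpa using ((this.mul_const (c n)).norm).pow 2
    refine le_of_tendsto hlim (Filter.Eventually.of_forall fun k => ?_)
    have hB := (fourierBasis (T := 1)).orthonormal.sum_inner_products_le (F k) (s := s)
    simp only [← HilbertBasis.repr_apply_apply, hFc] at hB
    exact hB.trans (pow_le_pow_left₀ (norm_nonneg _) (hFn k) 2)
  have hmem : Memℓp c 2 := memℓp_gen' (C := K ^ 2) fun s => by simpa using hsum s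
  set G : Lp ℂ 2 (haarAddCircle (T := 1)) := fourierBasis.repr.symm ⟨c, hmem⟩ with hG
  have hGc : ∀ n, fourierBasis.repr G n = c n := fun n => by
    rw [hG, LinearIsometryEquiv.apply_symm_apply]
  have hsc : Summable fun n => ‖c n‖ ^ 2 := by
    have := hmem.summable (by simp)
    simpa using this
  have hFG : Filter.Tendsto F Filter.atTop (𝓝 G) := by
    rw [tendsto_iff_norm_sub_tendsto_zero]
    have h1 : ∀ k, ‖F k - G‖ ^ 2 = ∑' n, ‖((fejer k n : ℂ) - 1) * c n‖ ^ 2 := by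
      intro k
      rw [← (fourierBasis (T := 1)).repr.norm_map]
      have := lp.norm_rpow_eq_tsum (p := 2) (by simp) ((fourierBasis (T := 1)).repr (F k - G))
      simp only [ENNReal.toReal_ofNat, Real.rpow_ofNat] at this
      rw [this]
      refine tsum_congr fun n => ?_
      rw [map_sub, lp.coeFn_sub, Pi.sub_apply, hFc, hGc, sub_mul, one_mul]
    have h2 : Filter.Tendsto (fun k => ∑' n, ‖((fejer k n : ℂ) - 1) * c n‖ ^ 2) Filter.atTop
        (𝓝 (∑' _ : ℤ, (0 : ℝ))) := by
      refine tendsto_tsum_of_dominated_convergence hsc (fun n => ?_)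
        (Filter.Eventually.of_forall fun k n => ?_)
      · have : Filter.Tendsto (fun k => (fejer k n : ℂ)) Filter.atTop (𝓝 ((1 : ℝ) : ℂ)) :=
          (Complex.continuous_ofReal.tendsto _).comp (tendsto_fejer n)
        simpa using (((this.sub_const 1).mul_const (c n)).norm).pow 2
      · rw [Real.norm_of_nonneg (by positivity), norm_mul]
        have : ‖(fejer k n : ℂ) - 1‖ ≤ 1 := by
          rw [← Complex.ofReal_one, ← Complex.ofReal_sub, Complex.norm_real, Real.norm_eq_abs,
            abs_le]
          constructor <;> linarith [fejer_nonneg k n, fejer_le_one k n]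
        exact pow_le_pow_left₀ (by positivity)
          (mul_le_of_le_one_left (norm_nonneg _) this) 2
    rw [tsum_zero] at h2
    have h3 := (Real.continuous_sqrt.tendsto _).comp (h2.congr fun k => (h1 k).symm)
    simpa [Function.comp_def, Real.sqrt_sq] using h3
  obtain ⟨ns, -, hns⟩ := (tendstoInMeasure_of_tendsto_Lp hFG).exists_seq_tendsto_ae
  have hGb : ∀ᵐ t ∂haarAddCircle, ‖G t‖ ≤ K := by
    filter_upwards [hns, ae_all_iff.2 hFb] with t ht hb
    exact le_of_tendsto ht.norm (Filter.Eventually.of_forall fun i => hb _)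
  refine ⟨G, memLp_top_of_bound (Lp.aestronglyMeasurable G) K hGb, fun n => ?_, hGb⟩
  rw [← fourierBasis_repr, hGc]

open AddCircle in
theorem ae_eq_of_fourierCoeff_eq {f g : UnitAddCircle → ℂ} (hf : MemLp f 2 haarAddCircle)
    (hg : MemLp g 2 haarAddCircle) (h : ∀ n, fourierCoeff f n = fourierCoeff g n) :
    f =ᵐ[haarAddCircle] g := by
  have : hf.toLp f = hg.toLp g := by
    refine (fourierBasis (T := 1)).repr.injective ?_
    ext n
    rw [fourierBasis_repr, fourierBasis_repr, fourierCoeff_congr_ae hf.coeFn_toLp,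
      fourierCoeff_congr_ae hg.coeFn_toLp, h]
  exact (MemLp.toLp_eq_toLp_iff hf hg).1 this

open AddCircle in
/-- The Fourier coefficients of a product of square integrable functions. -/
theorem hasSum_fourierCoeff_mul {f g : UnitAddCircle → ℂ} (hf : MemLp f 2 haarAddCircle)
    (hg : MemLp g 2 haarAddCircle) (n : ℤ) :
    HasSum (fun p => fourierCoeff f (n - p) * fourierCoeff g p)
      (fourierCoeff (fun t => f t * g t) n) := by
  -- With this `f'` the sum becomes Parseval's identity for the inner product of `f'` and `g`.
  set f' : UnitAddCircle → ℂ := fun t => fourier n t * starRingEnd ℂ (f t) with hf'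
  have hm : MemLp f' 2 haarAddCircle := by
    have h1 : MemLp (fun t => starRingEnd ℂ (f t)) 2 haarAddCircle := hf.star
    refine h1.of_le ((fourier n).continuous.aestronglyMeasurable.mul h1.aestronglyMeasurable) ?_
    refine Filter.Eventually.of_forall fun t => ?_
    rw [hf', norm_mul, fourier_apply, Circle.norm_coe, one_mul]
  have key := (fourierBasis (T := 1)).hasSum_inner_mul_inner (hm.toLp f') (hg.toLp g)
  have e1 : ∀ p, inner ℂ (fourierBasis p) (hg.toLp g) = fourierCoeff g p := fun p => by
    rw [← HilbertBasis.repr_apply_apply, fourierBasis_repr, fourierCoeff_congr_ae hg.coeFn_toLp]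
  have e2 : ∀ p, inner ℂ (hm.toLp f') (fourierBasis p) = fourierCoeff f (n - p) := fun p => by
    rw [← inner_conj_symm, ← HilbertBasis.repr_apply_apply, fourierBasis_repr,
      fourierCoeff_congr_ae hm.coeFn_toLp, fourierCoeff, fourierCoeff, ← integral_conj]
    refine integral_congr_ae (Filter.Eventually.of_forall fun t => ?_)
    simp only [hf', smul_eq_mul, map_mul, Complex.conj_conj, fourier_neg]
    rw [sub_eq_add_neg, fourier_add, fourier_neg, map_mul, Complex.conj_conj]
    ring
  have e3 : inner ℂ (hm.toLp f') (hg.toLp g) = fourierCoeff (fun t => f t * g t) n := by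
    rw [L2.inner_def, fourierCoeff]
    refine integral_congr_ae ?_
    filter_upwards [hm.coeFn_toLp, hg.coeFn_toLp] with t h1 h2
    rw [h1, h2]
    simp only [hf', RCLike.inner_apply, smul_eq_mul, map_mul, Complex.conj_conj, fourier_neg]
    ring
  simpa only [e1, e2, e3] using key

open AddCircle in
theorem fourierCoeff_tsum {c : ℤ → ℂ} (hc : Summable fun n => ‖c n‖) :
    MemLp (fun t : UnitAddCircle => ∑' n, c n * fourier n t) ⊤ haarAddCircle ∧
    ∀ n, fourierCoeff (fun t : UnitAddCircle => ∑' n, c n * fourier n t) n = c n := by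
  have hb : ∀ n (t : UnitAddCircle), ‖c n * fourier n t‖ ≤ ‖c n‖ := fun n t => by
    rw [norm_mul, fourier_apply, Circle.norm_coe, mul_one]
  have hcont : Continuous fun t : UnitAddCircle => ∑' n, c n * fourier n t :=
    continuous_tsum (fun n => (fourier n).continuous.const_mul _) hc hb
  refine ⟨memLp_top_of_bound hcont.aestronglyMeasurable (∑' n, ‖c n‖)
    (Filter.Eventually.of_forall fun t => tsum_of_norm_bounded hc.hasSum fun n => hb n t), ?_⟩
  intro n
  rw [fourierCoeff]
  have e : ∀ t : UnitAddCircle, fourier (-n) t • ∑' m, c m * fourier m t =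
      ∑' m, c m * fourier (m - n) t := fun t => by
    rw [smul_eq_mul, ← tsum_mul_left]
    refine tsum_congr fun m => ?_
    rw [sub_eq_add_neg, fourier_add]; ring
  simp only [e]
  have hI : ∀ m : ℤ, ∫ t : UnitAddCircle, c m * fourier (m - n) t ∂haarAddCircle =
      if m = n then c m else 0 := by
    intro m
    rw [integral_const_mul]
    have := congrFun (fourierCoeff_fourier (T := 1) m) n
    rw [fourierCoeff] at this
    have e' : ∀ t : UnitAddCircle, fourier (m - n) t = fourier (-n) t • fourier m t := fun t => by
      rw [smul_eq_mul, sub_eq_add_neg, fourier_add]; ring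
    simp only [e', this, Pi.single_apply, eq_comm (a := n)]
    split_ifs <;> simp
  rw [← integral_tsum_of_summable_integral_norm]
  · simp only [hI, tsum_ite_eq]
  · intro m
    exact ((fourier (m - n)).continuous.const_mul _).integrable_of_hasCompactSupport
      (HasCompactSupport.of_compactSpace _)
  · refine hc.congr fun m => ?_
    simp only [norm_mul, fourier_apply, Circle.norm_coe, mul_one, integral_const]
    simp

open AddCircle in
theorem norm_fourierCoeff_le {f : UnitAddCircle → ℂ} {K : ℝ}
    (hf : ∀ᵐ t ∂haarAddCircle, ‖f t‖ ≤ K) (n : ℤ) : ‖fourierCoeff f n‖ ≤ K := by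
  rw [fourierCoeff]
  have := norm_integral_le_of_norm_le_const (μ := haarAddCircle (T := 1))
    (f := fun t => fourier (-n) t • f t) (C := K) (by
      filter_upwards [hf] with t ht
      rwa [norm_smul, fourier_apply, Circle.norm_coe, one_mul])
  simpa using this

/-! ### Spectra of elements `a` with `b ^ m * a = p(b)` -/

section Algebra

open Polynomial

variable {R : Type*} [Ring R] [Algebra ℂ R]

theorem isUnit_of_mul_eq_algebraMap {a b : R} (hab : Commute a b) {c : ℂ} (hc : c ≠ 0)
    (h : a * b = algebraMap ℂ R c) : IsUnit a :=
  (hab.isUnit_mul_iff.1 (h ▸ (IsUnit.mk0 c hc).map (algebraMap ℂ R))).1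

theorem eval_div_pow_mem_spectrum {a b : R} (hab : Commute a b) {m : ℕ} {p : ℂ[X]}
    (h : b ^ m * a = aeval b p) {w : ℂ} (hw : w ∈ spectrum ℂ b) (hw0 : w ≠ 0) :
    p.eval w / w ^ m ∈ spectrum ℂ a := by
  set l := p.eval w / w ^ m with hl
  rw [spectrum.mem_iff]
  intro hu
  apply spectrum.mem_iff.1 hw
  have hwm : w ^ m ≠ 0 := pow_ne_zero _ hw0
  -- The two divisibilities read `(w - b) q(b) = b ^ m (l - a)` and `(w - b) r(b) = w ^ m - b ^ m`.
  -- If `l - a` is invertible, the first makes `b ^ m` a multiple of `w - b`; adding the second, so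
  -- is the nonzero scalar `w ^ m`.
  obtain ⟨q, hq⟩ : (C w - X) ∣ C l * X ^ m - p := by
    rw [← neg_sub X, neg_dvd, dvd_iff_isRoot, IsRoot.def]
    simp [hl, div_mul_cancel₀ _ hwm]
  obtain ⟨r, hr⟩ : (C w - X) ∣ C (w ^ m) - X ^ m := by
    rw [← neg_sub X, neg_dvd, dvd_iff_isRoot, IsRoot.def]
    simp
  have hq' := congrArg (aeval b) hq
  have hr' := congrArg (aeval b) hr
  simp only [map_sub, map_mul, aeval_C, aeval_X, aeval_X_pow] at hq' hr'
  rw [← h] at hq'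
  obtain ⟨u, hu⟩ := hu
  have hbu : Commute b u := by
    rw [hu]; exact (show Commute b (algebraMap ℂ R l) from (Algebra.commutes l b).symm).sub_right hab.symm
  have e1 : (algebraMap ℂ R w - b) * (aeval b q * ↑u⁻¹) = b ^ m := by
    rw [← mul_assoc, ← hq', Algebra.commutes l (b ^ m), ← mul_sub, ← hu, mul_assoc,
      Units.mul_inv, mul_one]
  have hbq : ∀ f : ℂ[X], Commute b (aeval b f) := fun f => by
    have := (Polynomial.aeval b).toRingHom.map_mul X f
    change aeval b (X * f) = aeval b X * aeval b f at this
    rw [mul_comm, map_mul, aeval_X] at this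
    exact this.symm
  refine isUnit_of_mul_eq_algebraMap (b := aeval b q * ↑u⁻¹ + aeval b r) ?_ hwm ?_
  · refine Commute.sub_left (Algebra.commutes w _) ?_
    exact ((hbq q).mul_right hbu.units_inv_right).add_right (hbq r)
  · rw [mul_add, e1, ← hr']; abel

/-- Since `m ≥ 1`, both `b ^ m * a` and the nonconstant part of `p(b)` contain a factor `b`, so the
nonzero constant `p(0)` is a multiple of `b`. -/
theorem isUnit_of_pow_mul_eq_aeval {a b : R} (hab : Commute a b) {m : ℕ} (hm : m ≠ 0) {p : ℂ[X]}
    (h : b ^ m * a = aeval b p) (hp : p.coeff 0 ≠ 0) : IsUnit b := by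
  have hbq : ∀ f : ℂ[X], Commute b (aeval b f) := fun f => by
    have := (Polynomial.aeval b).toRingHom.map_mul X f
    change aeval b (X * f) = aeval b X * aeval b f at this
    rw [mul_comm, map_mul, aeval_X] at this
    exact this.symm
  have h' := congrArg (aeval b) p.divX_mul_X_add
  simp only [map_add, map_mul, aeval_C, aeval_X] at h'
  obtain ⟨m, rfl⟩ := Nat.exists_eq_succ_of_ne_zero hm
  refine isUnit_of_mul_eq_algebraMap (b := b ^ m * a - aeval b p.divX) ?_ hp ?_
  · exact (((Commute.refl b).pow_right m).mul_right hab.symm).sub_right (hbq _)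
  · rw [mul_sub, ← mul_assoc, ← pow_succ', h, (hbq _).eq, ← h']; abel

end Algebra

/-! ### The bounded shift and bounded convolutions -/

namespace SequenceSpace

variable {E : Type*} [NormedAddCommGroup E] [NormedSpace ℂ E] {X : SequenceSpace E}

variable (X) in
/-- `S` is the shift as a bounded operator on `E`. -/
def IsShift (S : E →L[ℂ] E) : Prop := ∀ x, X.coord (S x) = seqShift (X.coord x)

theorem IsShift.coord_apply {S : E →L[ℂ] E} (hS : X.IsShift S) (x : E) (n : ℤ) :
    X.coord (S x) n = X.coord x (n - 1) := by rw [hS, seqShift_apply]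

/-- Closed graph theorem: the coordinates are continuous and separate points, so they identify the
limit. -/
theorem ShiftBounded.exists_isShift [CompleteSpace E] (h2 : X.H2) (h : X.ShiftBounded) :
    ∃ S : E →L[ℂ] E, X.IsShift S := by
  choose f hf using h
  let L : E →ₗ[ℂ] E :=
    { toFun := f
      map_add' := fun x y => X.coord_injective (by simp only [map_add, hf])
      map_smul' := fun c x => X.coord_injective (by simp only [map_smul, hf, RingHom.id_apply]) }
  have hL : Continuous L := by
    refine L.continuous_of_seq_closed_graph fun u x y hu hv => ?_
    refine coord_ext (X := X) fun n => ?_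
    have e1 := ((h2 n).tendsto y).comp hv
    have e2 := ((h2 (n - 1)).tendsto x).comp hu
    have : ∀ i, X.coord (L (u i)) n = X.coord (u i) (n - 1) := fun i => by
      change X.coord (f (u i)) n = _
      rw [hf, seqShift_apply]
    simp only [Function.comp_def, this] at e1 e2
    rw [tendsto_nhds_unique e1 e2]
    change _ = X.coord (f x) n
    rw [hf, seqShift_apply]
  exact ⟨⟨L, hL⟩, hf⟩

section Shift

variable {S : E →L[ℂ] E}

theorem IsShift.mem_finiteSeq (hS : X.IsShift S) {a : E} (ha : a ∈ X.finiteSeq) :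
    S a ∈ X.finiteSeq := by
  change (X.coord (S a)).support.Finite
  rw [hS]
  exact (show (X.coord a).support.Finite from ha).preimage (sub_left_injective.injOn)

theorem IsShift.isMultiplier_iff (h1 : X.H1) (hS : X.IsShift S) {M : E →L[ℂ] E} :
    X.IsMultiplier M ↔ Commute M S := by
  constructor
  · intro hM
    ext x
    revert x
    refine h1.induction (isClosed_eq (M * S).continuous (S * M).continuous) fun a ha => ?_
    refine X.coord_injective ?_
    change X.coord (M (S a)) = X.coord (S (M a))
    rw [hS, hM a (S a) ha (hS a)]
  · intro hM a b _ hb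
    have : b = S a := X.coord_injective (by rw [hb, hS])
    rw [this, ← hS]
    congr 1
    exact congrArg (fun T : E →L[ℂ] E => T a) hM.eq

theorem IsShift.coord_pow (hS : X.IsShift S) (m : ℕ) (x : E) (n : ℤ) :
    X.coord ((S ^ m) x) n = X.coord x (n - m) := by
  induction m generalizing n with
  | zero => simp
  | succ m ih =>
    rw [pow_succ']
    change X.coord (S ((S ^ m) x)) n = _
    rw [hS.coord_apply, ih]
    push_cast; ring_nf

open Polynomial in
/-- The polynomial `X ^ m φ(X)`, if `φ n = 0` for `n < -m`. -/
def shiftedPoly (φ : ℤ →₀ ℂ) (m : ℕ) : ℂ[X] :=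
  ∑ k ∈ φ.support, Polynomial.monomial (k + m).toNat (φ k)

theorem IsShift.pow_mul_eq_aeval (hS : X.IsShift S) {φ : ℤ →₀ ℂ} {T : E →L[ℂ] E}
    (hT : X.IsConvolution φ T) {m : ℕ} (hm : ∀ n : ℤ, n < -m → φ n = 0) :
    S ^ m * T = Polynomial.aeval S (shiftedPoly φ m) := by
  ext x
  refine coord_ext (X := X) fun n => ?_
  have e : Polynomial.aeval S (shiftedPoly φ m) = ∑ k ∈ φ.support, φ k • S ^ (k + m).toNat := by
    simp only [shiftedPoly, map_sum, Polynomial.aeval_monomial, Algebra.smul_def]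
  rw [e]
  change X.coord ((S ^ m) (T x)) n = _
  rw [hS.coord_pow, hT]
  simp only [_root_.sum_apply, _root_.smul_apply, map_sum, map_smul,
    Finset.sum_apply, Pi.smul_apply, smul_eq_mul, hS.coord_pow]
  refine Finset.sum_congr rfl fun k hk => ?_
  have : -(m : ℤ) ≤ k := by
    by_contra h
    exact Finsupp.mem_support_iff.1 hk (hm k (by omega))
  rw [Int.toNat_of_nonneg (by omega)]
  ring_nf

theorem eval_shiftedPoly {φ : ℤ →₀ ℂ} {m : ℕ} (hm : ∀ n : ℤ, n < -m → φ n = 0) {w : ℂ}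
    (hw : w ≠ 0 ∨ m = 0) :
    (shiftedPoly φ m).eval w = w ^ m * φ.sum fun k c => c * w ^ k := by
  simp only [shiftedPoly, Polynomial.eval_finsetSum, Polynomial.eval_monomial, Finsupp.sum,
    Finset.mul_sum]
  refine Finset.sum_congr rfl fun k hk => ?_
  have : -(m : ℤ) ≤ k := by
    by_contra h
    exact Finsupp.mem_support_iff.1 hk (hm k (by omega))
  rw [← zpow_natCast, Int.toNat_of_nonneg (by omega)]
  rcases hw with hw | rfl
  · rw [zpow_add₀ hw, zpow_natCast]; ring
  · simp

theorem exists_neg_bound (φ : ℤ →₀ ℂ) : ∃ m : ℕ, ∀ n : ℤ, n < -m → φ n = 0 := by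
  refine ⟨φ.support.sup Int.natAbs, fun n hn => ?_⟩
  by_contra h
  have := Finset.le_sup (f := Int.natAbs) (Finsupp.mem_support_iff.2 h)
  omega

theorem IsShift.isConvolution (hS : X.IsShift S) : X.IsConvolution (Finsupp.single 1 1) S := by
  intro x n
  rw [Finsupp.sum_single_index (by simp), one_mul, hS.coord_apply]

theorem IsShift.commute (h1 : X.H1) (hS : X.IsShift S) {φ : ℤ →₀ ℂ} {T : E →L[ℂ] E}
    (hT : X.IsConvolution φ T) : Commute T S :=
  (hS.isMultiplier_iff h1).1 hT.isMultiplier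

/-- If the lowest nonzero coefficient had index `-(m + 1)`, then `S ^ (m + 1) * T` would be a
polynomial in `S` with nonzero constant term, and `S` would be invertible. This is what gives
symbols a meaning at `0 ∈ σ(S)`. -/
theorem IsShift.eq_zero_of_neg (h1 : X.H1) (hS : X.IsShift S) (hu : ¬ IsUnit S) {φ : ℤ →₀ ℂ}
    {T : E →L[ℂ] E} (hT : X.IsConvolution φ T) {n : ℤ} (hn : n < 0) : φ n = 0 := by
  have key : ∀ m : ℕ, (∀ n : ℤ, n < -m → φ n = 0) → ∀ n : ℤ, n < 0 → φ n = 0 := by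
    intro m
    induction m with
    | zero => intro h n hn; exact h n (by simpa using hn)
    | succ m ih =>
      intro h
      refine ih fun n hn => ?_
      rcases (show n < -((m + 1 : ℕ) : ℤ) ∨ n = -((m + 1 : ℕ) : ℤ) by push_cast; omega)
        with hn' | hn'
      · exact h n hn'
      by_contra hne
      refine hu (isUnit_of_pow_mul_eq_aeval (hS.commute h1 hT) (Nat.succ_ne_zero m)
        (hS.pow_mul_eq_aeval hT h) ?_)
      have : (shiftedPoly φ (m + 1)).coeff 0 = φ n := by
        simp only [shiftedPoly, Polynomial.finsetSum_coeff, Polynomial.coeff_monomial]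
        rw [Finset.sum_eq_single n]
        · rw [if_pos (by omega)]
        · intro k hk hkn
          rw [if_neg]
          intro h0
          refine Finsupp.mem_support_iff.1 hk (h k ?_)
          omega
        · intro hns
          rw [Finsupp.notMem_support_iff.1 hns, ite_self]
      rwa [this]
  obtain ⟨m, hm⟩ := exists_neg_bound φ
  exact key m hm n hn

/-- The spectral inclusion for convolutions. -/
theorem IsShift.sum_mem_spectrum (h1 : X.H1) (hS : X.IsShift S) {φ : ℤ →₀ ℂ} {T : E →L[ℂ] E}
    (hT : X.IsConvolution φ T) {w : ℂ} (hw : w ∈ spectrum ℂ S) :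
    (φ.sum fun k c => c * w ^ k) ∈ spectrum ℂ T := by
  by_cases hw0 : w = 0
  · have hu : ¬ IsUnit S := by
      have := spectrum.mem_iff.1 hw
      rw [hw0, map_zero, zero_sub, IsUnit.neg_iff] at this
      exact this
    have hm : ∀ n : ℤ, n < -(0 : ℕ) → φ n = 0 := fun n hn =>
      hS.eq_zero_of_neg h1 hu hT (by simpa using hn)
    have e := hS.pow_mul_eq_aeval hT hm
    have e' := eval_shiftedPoly hm (w := w) (Or.inr rfl)
    rw [pow_zero, one_mul] at e e'
    rw [← e', e]
    exact spectrum.subset_polynomial_aeval S _ ⟨w, hw, rfl⟩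
  · obtain ⟨m, hm⟩ := exists_neg_bound φ
    have := eval_div_pow_mem_spectrum (hS.commute h1 hT) (hS.pow_mul_eq_aeval hT hm) hw hw0
    rwa [eval_shiftedPoly hm (Or.inl hw0), mul_div_cancel_left₀ _ (pow_ne_zero _ hw0)] at this

theorem nontrivial (X : SequenceSpace E) : Nontrivial E := ⟨⟨X.e0, 0, X.e0_ne_zero⟩⟩

theorem IsShift.norm_sum_le [CompleteSpace E] (h1 : X.H1) (hS : X.IsShift S) {φ : ℤ →₀ ℂ}
    {T : E →L[ℂ] E} (hT : X.IsConvolution φ T) {w : ℂ} (hw : w ∈ spectrum ℂ S) :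
    ‖φ.sum fun k c => c * w ^ k‖ ≤ ‖T‖ := by
  have := X.nontrivial
  exact spectrum.norm_le_norm_of_mem (hS.sum_mem_spectrum h1 hT hw)

/-- Used to recover the coefficient of index `n` of a multiplier from its Cesàro mean of order
`|n|`. -/
theorem fejer_ne_zero (n : ℤ) : fejer n.natAbs n ≠ 0 := by
  unfold fejer
  have : ((n.natAbs : ℤ) + 1 - |n|).toNat = 1 := by
    rw [Int.abs_eq_natAbs]; omega
  rw [this]
  positivity

/-- The spectrum of the shift is invariant under rotations. -/
theorem IsShift.mul_mem_spectrum (h1 : X.H1) (h2 : X.H2) (h3 : X.H3) (hS : X.IsShift S) {w z : ℂ}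
    (hw : w ∈ spectrum ℂ S) (hz : ‖z‖ = 1) : z * w ∈ spectrum ℂ S := by
  obtain ⟨ψ, C, hC0, hψ, hψn, -⟩ := exists_rotation h1 h2 h3
  let Ψ : ∀ u : ℂ, ‖u‖ = 1 → (E →L[ℂ] E) := fun u hu =>
    LinearMap.mkContinuous
      { toFun := ψ u
        map_add' := fun x y => coord_ext (X := X) fun n => by
          simp only [map_add, Pi.add_apply, hψ u hu, add_mul]
        map_smul' := fun c x => coord_ext (X := X) fun n => by
          simp only [map_smul, Pi.smul_apply, hψ u hu, RingHom.id_apply, smul_eq_mul, mul_assoc] }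
      C (hψn u hu)
  have hΨ : ∀ u hu x n, X.coord (Ψ u hu x) n = X.coord x n * u ^ n := fun u hu => hψ u hu
  have hz0 : z ≠ 0 := fun h => by rw [h] at hz; simp at hz
  have hzi : ‖z⁻¹‖ = 1 := by rw [norm_inv, hz, inv_one]
  let U : (E →L[ℂ] E)ˣ :=
    { val := Ψ z hz
      inv := Ψ z⁻¹ hzi
      val_inv := by
        ext x
        refine coord_ext (X := X) fun n => ?_
        change X.coord (Ψ z hz (Ψ z⁻¹ hzi x)) n = X.coord x n
        rw [hΨ, hΨ, inv_zpow, inv_mul_cancel_right₀ (zpow_ne_zero _ hz0)] <;> assumption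
      inv_val := by
        ext x
        refine coord_ext (X := X) fun n => ?_
        change X.coord (Ψ z⁻¹ hzi (Ψ z hz x)) n = X.coord x n
        rw [hΨ, hΨ, inv_zpow, mul_inv_cancel_right₀ (zpow_ne_zero _ hz0)] <;> assumption }
  -- Conjugation by the rotation multiplies `S` by `z`, so `σ(S) = z σ(S)`.
  have hU : (U : E →L[ℂ] E) * S * (U⁻¹ : (E →L[ℂ] E)ˣ) = Units.mk0 z hz0 • S := by
    ext x
    refine coord_ext (X := X) fun n => ?_
    change X.coord (Ψ z hz (S (Ψ z⁻¹ hzi x))) n = X.coord (z • S x) n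
    rw [hΨ, hS.coord_apply, hΨ, map_smul, Pi.smul_apply, hS.coord_apply, inv_zpow, mul_assoc,
      ← zpow_neg, ← zpow_add₀ hz0, mul_comm, smul_eq_mul] <;> try assumption
    congr 1
    rw [show -(n - 1) + n = 1 by ring, zpow_one]
  have h := spectrum.units_conjugate (R := ℂ) (a := S) (u := U)
  rw [hU, spectrum.unit_smul_eq_smul] at h
  rw [← h]
  exact ⟨w, hw, rfl⟩

end Shift

end SequenceSpace

theorem zpow_mul_zpow_sub {r : ℂ} {n p : ℤ} (h : r ≠ 0 ∨ n ≠ 0 ∨ p = 0) :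
    r ^ (n - p) * r ^ p = r ^ n := by
  by_cases hr : r = 0
  · subst hr
    rcases h with h | h | rfl
    · exact absurd rfl h
    · rw [zero_zpow n h, mul_eq_zero]
      by_cases hp : p = 0
      · left; rw [hp, sub_zero, zero_zpow n h]
      · right; rw [zero_zpow p hp]
    · simp
  · rw [← zpow_add₀ hr, sub_add_cancel]

/-! ### Symbols on a rotation invariant set -/

namespace SequenceSpace

variable {E : Type*} [NormedAddCommGroup E] [NormedSpace ℂ E] {X : SequenceSpace E}

variable (X) in
/-- A rotation invariant set of points at which the Cesàro means of the symbols of all multipliers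
are bounded. -/
structure IsSymbolDomain (A : Set ℂ) (K : ℝ) : Prop where
  const_nonneg : 0 ≤ K
  mul_mem : ∀ z ∈ A, ∀ u : ℂ, ‖u‖ = 1 → u * z ∈ A
  norm_sum_le : ∀ M : E →L[ℂ] E, X.IsMultiplier M → ∀ k, ∀ z ∈ A,
    ‖(X.cesaroCoeff M k).sum fun n c => c * z ^ n‖ ≤ K * ‖M‖
  coeff_eq_zero : 0 ∈ A → ∀ M : E →L[ℂ] E, X.IsMultiplier M → ∀ n < 0, X.symbolCoeff M n = 0

theorem cesaroCoeff_sum (M : E →L[ℂ] E) (k : ℕ) (z : ℂ) :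
    ((X.cesaroCoeff M k).sum fun n c => c * z ^ n) =
      ∑ n ∈ Finset.Icc (-(k : ℤ)) k, fejer k n * X.symbolCoeff M n * z ^ n := by
  refine Finsupp.sum_of_support_subset _ Finsupp.support_onFinset_subset _ fun n _ => ?_
  rw [zero_mul]

theorem fourier_eq_zpow (n : ℤ) (t : UnitAddCircle) :
    fourier n t = (AddCircle.toCircle t : ℂ) ^ n := by
  rw [fourier_apply, AddCircle.toCircle_zsmul, Circle.coe_zpow]

theorem mul_toCircle_mem_sphere {r : ℝ} (hr : 0 ≤ r) (t : UnitAddCircle) :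
    (r : ℂ) * (AddCircle.toCircle t : ℂ) ∈ Metric.sphere (0 : ℂ) r := by
  rw [mem_sphere_zero_iff_norm, norm_mul, Circle.norm_coe, mul_one, Complex.norm_real,
    Real.norm_of_nonneg hr]

theorem exists_mul_toCircle_eq (z : ℂ) :
    ∃ t : UnitAddCircle, (‖z‖ : ℂ) * (AddCircle.toCircle t : ℂ) = z := by
  by_cases hz : z = 0
  · exact ⟨0, by simp [hz]⟩
  obtain ⟨t, ht⟩ := (AddCircle.homeomorphCircle (T := 1) one_ne_zero).surjective
    (⟨z / ‖z‖, by simp [Submonoid.unitSphere, hz]⟩ : Circle)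
  refine ⟨t, ?_⟩
  rw [AddCircle.homeomorphCircle_apply] at ht
  rw [ht]
  have : (‖z‖ : ℂ) ≠ 0 := by exact_mod_cast norm_ne_zero_iff.2 hz
  exact mul_div_cancel₀ _ this

section Domain

variable {A : Set ℂ} {K : ℝ}

theorem IsSymbolDomain.sphere_subset (hA : X.IsSymbolDomain A K) {z : ℂ} (hz : z ∈ A) :
    Metric.sphere (0 : ℂ) ‖z‖ ⊆ A := by
  intro w hw
  rw [mem_sphere_zero_iff_norm] at hw
  by_cases hz0 : z = 0
  · have : w = 0 := by rw [← norm_eq_zero, hw, hz0, norm_zero]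
    rwa [this, ← hz0]
  · have := hA.mul_mem z hz (w / z) (by rw [norm_div, hw, div_self (norm_ne_zero_iff.2 hz0)])
    rwa [div_mul_cancel₀ _ hz0] at this

/-- The symbol of a multiplier on a circle. -/
theorem IsSymbolDomain.exists_symbol_on_circle (hA : X.IsSymbolDomain A K)
    {M : E →L[ℂ] E} (hM : X.IsMultiplier M) {r : ℝ}
    (hr : 0 ≤ r) (hrA : Metric.sphere (0 : ℂ) r ⊆ A) :
    ∃ G : UnitAddCircle → ℂ, MemLp G ⊤ AddCircle.haarAddCircle ∧
      (∀ n, fourierCoeff G n = X.symbolCoeff M n * (r : ℂ) ^ n) ∧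
      ∀ᵐ t ∂AddCircle.haarAddCircle, ‖G t‖ ≤ K * ‖M‖ := by
  refine exists_Lp_fourierCoeff_eq (mul_nonneg hA.const_nonneg (norm_nonneg _)) fun k t => ?_
  have h := hA.norm_sum_le M hM k _ (hrA (mul_toCircle_mem_sphere hr t))
  rw [cesaroCoeff_sum] at h
  convert h using 3 with n
  rw [mul_zpow, fourier_eq_zpow]
  ring

theorem IsSymbolDomain.norm_symbolCoeff_le (hA : X.IsSymbolDomain A K) {M : E →L[ℂ] E}
    (hM : X.IsMultiplier M) {z : ℂ}
    (hz : z ∈ A) (n : ℤ) : ‖X.symbolCoeff M n‖ * ‖z‖ ^ n ≤ K * ‖M‖ := by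
  obtain ⟨G, -, hG, hb⟩ := hA.exists_symbol_on_circle hM (norm_nonneg z) (hA.sphere_subset hz)
  have := norm_fourierCoeff_le hb n
  rw [hG, norm_mul, norm_zpow, Complex.norm_real, norm_norm] at this
  exact this

theorem IsSymbolDomain.ae_norm_le (hA : X.IsSymbolDomain A K)
    {M : E →L[ℂ] E} (hM : X.IsMultiplier M) {r : ℝ} (hr : 0 ≤ r)
    (hrA : Metric.sphere (0 : ℂ) r ⊆ A) {f : UnitAddCircle → ℂ}
    (hf : MemLp f ⊤ AddCircle.haarAddCircle)
    (hfc : ∀ n, fourierCoeff f n = X.symbolCoeff M n * (r : ℂ) ^ n) :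
    ∀ᵐ t ∂AddCircle.haarAddCircle, ‖f t‖ ≤ K * ‖M‖ := by
  obtain ⟨G, hGm, hG, hb⟩ := hA.exists_symbol_on_circle hM hr hrA
  have := ae_eq_of_fourierCoeff_eq (hf.mono_exponent le_top) (hGm.mono_exponent le_top)
    (fun n => by rw [hfc, hG])
  filter_upwards [this, hb] with t h1 h2
  rwa [h1]

/-- Symbols are multiplicative. -/
theorem IsSymbolDomain.fourierCoeff_mul (hA : X.IsSymbolDomain A K) (h1 : X.H1) (h2 : X.H2)
    (h3 : X.H3) {M N : E →L[ℂ] E} (hM : X.IsMultiplier M) (hN : X.IsMultiplier N) {r : ℝ}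
    (hrA : Metric.sphere (0 : ℂ) r ⊆ A) {f g : UnitAddCircle → ℂ}
    (hf : MemLp f ⊤ AddCircle.haarAddCircle)
    (hfc : ∀ n, fourierCoeff f n = X.symbolCoeff M n * (r : ℂ) ^ n)
    (hg : MemLp g ⊤ AddCircle.haarAddCircle)
    (hgc : ∀ n, fourierCoeff g n = X.symbolCoeff N n * (r : ℂ) ^ n) (n : ℤ) :
    fourierCoeff (fun t => f t * g t) n = X.symbolCoeff (M * N) n * (r : ℂ) ^ n := by
  have hs := hasSum_fourierCoeff_mul (hf.mono_exponent le_top) (hg.mono_exponent le_top) n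
  have hterm : ∀ p, fourierCoeff f (n - p) * fourierCoeff g p =
      X.symbolCoeff N p * X.symbolCoeff M (n - p) * (r : ℂ) ^ n := by
    intro p
    rw [hfc, hgc]
    by_cases h : (r : ℂ) ≠ 0 ∨ n ≠ 0 ∨ p = 0
    · rw [← zpow_mul_zpow_sub h]; ring
    -- The exceptional case `r = 0`, `n = 0`, `p ≠ 0`: here `0 ^ (-p) * 0 ^ p` is `0` and not `0 ^
    -- 0`. One of `p` and `n - p` is negative, so the product of coefficients vanishes anyway.
    · push Not at h
      obtain ⟨hr0, hn, hp⟩ := h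
      have h0 : (0 : ℂ) ∈ A := hrA (by
        rw [mem_sphere_zero_iff_norm, norm_zero]; exact_mod_cast hr0.symm)
      have : X.symbolCoeff N p * X.symbolCoeff M (n - p) = 0 := by
        rcases lt_or_gt_of_ne hp with hp | hp
        · rw [hA.coeff_eq_zero h0 N hN p hp, zero_mul]
        · rw [hA.coeff_eq_zero h0 M hM (n - p) (by omega), mul_zero]
      rw [hr0, zero_zpow p hp, this]; simp
  have hlim1 : Filter.Tendsto (fun k : ℕ => ∑' p, (fejer k p : ℂ) *
      (fourierCoeff f (n - p) * fourierCoeff g p)) Filter.atTop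
      (𝓝 (∑' p, fourierCoeff f (n - p) * fourierCoeff g p)) := by
    refine tendsto_tsum_of_dominated_convergence hs.summable.norm (fun p => ?_)
      (Filter.Eventually.of_forall fun k p => ?_)
    · have : Filter.Tendsto (fun k => (fejer k p : ℂ)) Filter.atTop (𝓝 ((1 : ℝ) : ℂ)) :=
        (Complex.continuous_ofReal.tendsto _).comp (tendsto_fejer p)
      simpa using this.mul_const (fourierCoeff f (n - p) * fourierCoeff g p)
    · rw [norm_mul, Complex.norm_real, Real.norm_of_nonneg (fejer_nonneg k p)]
      exact mul_le_of_le_one_left (norm_nonneg _) (fejer_le_one k p)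
  -- `N e_0` need not be finitely supported, so `M` is not known to act on it as a convolution. It
  -- does so on the Cesàro means of `N e_0`, which converge to it; the same weights inserted in the
  -- absolutely convergent series tend to its sum.
  have hlim2 : Filter.Tendsto (fun k : ℕ => X.coord (M (X.cesaro k (N X.e0))) n * (r : ℂ) ^ n)
      Filter.atTop (𝓝 (X.symbolCoeff (M * N) n * (r : ℂ) ^ n)) :=
    Filter.Tendsto.mul_const _ ((((h2 n).comp M.continuous).tendsto _).comp
      (tendsto_cesaro h1 h2 h3 (N X.e0)))
  have heq : ∀ k : ℕ, ∑' p, (fejer k p : ℂ) * (fourierCoeff f (n - p) * fourierCoeff g p) =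
      X.coord (M (X.cesaro k (N X.e0))) n * (r : ℂ) ^ n := by
    intro k
    rw [tsum_eq_sum (s := Finset.Icc (-(k : ℤ)) k) fun p hp => by
      rw [fejer_eq_zero hp, Complex.ofReal_zero, zero_mul]]
    rw [hM.coord_apply (s := Finset.Icc (-(k : ℤ)) k) fun p hp => by
      rw [coord_cesaro, fejer_eq_zero hp, Complex.ofReal_zero, zero_mul], Finset.sum_mul]
    refine Finset.sum_congr rfl fun p _ => ?_
    rw [hterm, coord_cesaro, symbolCoeff, symbolCoeff]
    ring
  simp only [heq] at hlim1
  rw [← hs.tsum_eq]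
  exact tendsto_nhds_unique hlim1 hlim2

/-- A symbol of `M` stays away from `l` if `M - l` has an inverse that is a multiplier. -/
theorem IsSymbolDomain.exists_ae_le_norm_sub (hA : X.IsSymbolDomain A K) (h1 : X.H1)
    (h2 : X.H2) (h3 : X.H3) {M N : E →L[ℂ] E}
    (hM : X.IsMultiplier M) (hN : X.IsMultiplier N) {l : ℂ} (hMN : M * N = 1 + l • N) :
    ∃ δ > 0, ∀ r : ℝ, 0 ≤ r → Metric.sphere (0 : ℂ) r ⊆ A → ∀ f : UnitAddCircle → ℂ,
      MemLp f ⊤ AddCircle.haarAddCircle →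
      (∀ n, fourierCoeff f n = X.symbolCoeff M n * (r : ℂ) ^ n) →
      ∀ᵐ t ∂AddCircle.haarAddCircle, δ ≤ ‖f t - l‖ := by
  have hB : 0 ≤ K * ‖N‖ := mul_nonneg hA.const_nonneg (norm_nonneg _)
  -- The symbol `G` of `N` satisfies `(f - l) G = 1` and `‖G‖ ≤ K * ‖N‖` almost everywhere, the same
  -- bound on every circle. The summand `1` keeps the denominator positive.
  refine ⟨1 / (K * ‖N‖ + 1), by positivity, fun r hr hrA f hf hfc => ?_⟩
  obtain ⟨G, hGm, hG, hb⟩ := hA.exists_symbol_on_circle hN hr hrA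
  have hone : MemLp (fourier 0 : UnitAddCircle → ℂ) ⊤ AddCircle.haarAddCircle :=
    memLp_top_of_bound (fourier 0).continuous.aestronglyMeasurable 1
      (Filter.Eventually.of_forall fun t => by rw [fourier_apply, Circle.norm_coe])
  have hae : (fun t => f t * G t) =ᵐ[AddCircle.haarAddCircle]
      ((fourier 0 : UnitAddCircle → ℂ) + l • G) := by
    refine ae_eq_of_fourierCoeff_eq ((hGm.mul' hf (r := ⊤)).mono_exponent le_top)
      ((hone.add (hGm.const_smul l)).mono_exponent le_top) fun n => ?_
    rw [hA.fourierCoeff_mul h1 h2 h3 hM hN hrA hf hfc hGm hG, fourierCoeff.add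
      (hone.integrable le_top) ((hGm.const_smul l).integrable le_top), Pi.add_apply,
      fourierCoeff_fourier, fourierCoeff.const_smul, hG, hMN]
    simp only [symbolCoeff, _root_.add_apply, _root_.smul_apply, map_add, map_smul, Pi.add_apply,
      Pi.smul_apply, one_apply_eq_self, coord_e0_apply, Pi.single_apply, smul_eq_mul,
      add_mul, ite_mul, one_mul, zero_mul]
    by_cases hn : n = 0
    · subst hn; simp
    · simp [hn, mul_assoc]
  filter_upwards [hae, hb] with t ht hbt
  simp only [Pi.add_apply, fourier_zero, Pi.smul_apply, smul_eq_mul] at ht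
  have h : (f t - l) * G t = 1 := by rw [sub_mul, ht]; ring
  have h' := congrArg norm h
  rw [norm_mul, norm_one] at h'
  rw [div_le_iff₀ (by positivity)]
  nlinarith [norm_nonneg (f t - l), norm_nonneg (G t)]

theorem IsSymbolDomain.interior_mul_mem (hA : X.IsSymbolDomain A K) {z : ℂ}
    (hz : z ∈ interior A) {u : ℂ} (hu : ‖u‖ = 1) :
    u * z ∈ interior A := by
  have hu0 : u ≠ 0 := fun h => by rw [h] at hu; simp at hu
  refine interior_maximal (s := A) (t := (fun w => u⁻¹ * w) ⁻¹' interior A) ?_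
    (isOpen_interior.preimage (continuous_const_mul _)) ?_
  · intro w hw
    have := hA.mul_mem _ (interior_subset hw) u hu
    rwa [mul_inv_cancel_left₀ hu0] at this
  · change u⁻¹ * (u * z) ∈ interior A
    rwa [inv_mul_cancel_left₀ hu0]

theorem IsSymbolDomain.summable (hA : X.IsSymbolDomain A K) {M : E →L[ℂ] E}
    (hM : X.IsMultiplier M) {z : ℂ}
    (hz : z ∈ interior A) : Summable fun n : ℤ => ‖X.symbolCoeff M n * z ^ n‖ := by
  by_cases hz0 : z = 0
  · refine summable_of_ne_finset_zero (s := {0}) fun n hn => ?_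
    rw [hz0, zero_zpow n (by simpa using hn), mul_zero, norm_zero]
  have hzp : 0 < ‖z‖ := norm_pos_iff.2 hz0
  obtain ⟨ε, hε, hball⟩ := Metric.isOpen_iff.1 isOpen_interior z hz
  have hmem : ∀ s : ℝ, |s - 1| * ‖z‖ < ε → (s : ℂ) * z ∈ A := fun s hs => by
    refine interior_subset (hball ?_)
    rw [Metric.mem_ball, dist_eq_norm, ← sub_one_mul, norm_mul, ← Complex.ofReal_one,
      ← Complex.ofReal_sub, Complex.norm_real, Real.norm_eq_abs]
    exact hs
  obtain ⟨δ, hδ0, hδ1, hδ⟩ : ∃ δ : ℝ, 0 < δ ∧ δ < 1 ∧ δ * ‖z‖ < ε := by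
    refine ⟨min (1 / 2) (ε / (2 * ‖z‖)), by positivity, by
      exact lt_of_le_of_lt (min_le_left _ _) (by norm_num), ?_⟩
    calc _ ≤ ε / (2 * ‖z‖) * ‖z‖ := mul_le_mul_of_nonneg_right (min_le_right _ _) hzp.le
      _ < ε := by field_simp; linarith
  -- Both `(1 + δ) z` and `(1 - δ) z` lie in `A`. The coefficient bound on the larger circle gives
  -- geometric decay as `n → ∞`, that on the smaller one as `n → -∞`.
  have hb : ∀ s : ℝ, 0 < s → |s - 1| = δ → ∀ n : ℤ,
      ‖X.symbolCoeff M n * z ^ n‖ ≤ K * ‖M‖ * (s⁻¹) ^ n := by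
    intro s hs hsδ n
    have := hA.norm_symbolCoeff_le hM (hmem s (by rwa [hsδ])) n
    rw [norm_mul, Complex.norm_real, Real.norm_of_nonneg hs.le, mul_zpow] at this
    rw [norm_mul, norm_zpow, inv_zpow, ← div_eq_mul_inv, le_div_iff₀ (zpow_pos hs n)]
    linarith
  refine Summable.of_nat_of_neg ?_ ?_
  · refine Summable.of_nonneg_of_le (fun n => norm_nonneg _)
      (fun n => hb (1 + δ) (by linarith) (by rw [add_sub_cancel_left, abs_of_pos hδ0]) n) ?_
    simp only [zpow_natCast]
    exact (summable_geometric_of_lt_one (by positivity)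
      (inv_lt_one_of_one_lt₀ (by linarith))).mul_left _
  · refine Summable.of_nonneg_of_le (fun n => norm_nonneg _)
      (fun n => hb (1 - δ) (by linarith) (by
        rw [sub_sub_cancel_left, abs_neg, abs_of_pos hδ0]) (-n)) ?_
    simp only [zpow_neg, zpow_natCast, inv_pow, inv_inv]
    exact (summable_geometric_of_lt_one (by linarith) (by linarith)).mul_left _

open Classical in
theorem IsSymbolDomain.exists_symbol (hA : X.IsSymbolDomain A K) {M : E →L[ℂ] E}
    (hM : X.IsMultiplier M) :
    ∃ g : ℂ → ℂ,
      (∀ z ∈ interior A, HasSum (fun n : ℤ => X.symbolCoeff M n * z ^ n) (g z)) ∧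
      ∀ r : ℝ, 0 ≤ r → Metric.sphere (0 : ℂ) r ⊆ A →
        MemLp (onCircle g r) ⊤ AddCircle.haarAddCircle ∧
        ∀ n : ℤ, fourierCoeff (onCircle g r) n = X.symbolCoeff M n * (r : ℂ) ^ n := by
  have hex : ∀ r : ℝ, ∃ G : UnitAddCircle → ℂ, 0 ≤ r → Metric.sphere (0 : ℂ) r ⊆ A →
      MemLp G ⊤ AddCircle.haarAddCircle ∧
      ∀ n, fourierCoeff G n = X.symbolCoeff M n * (r : ℂ) ^ n := by
    intro r
    by_cases h : 0 ≤ r ∧ Metric.sphere (0 : ℂ) r ⊆ A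
    · obtain ⟨G, hG, hG', -⟩ := hA.exists_symbol_on_circle hM h.1 h.2
      exact ⟨G, fun _ _ => ⟨hG, hG'⟩⟩
    · exact ⟨0, fun h1 h2 => absurd ⟨h1, h2⟩ h⟩
  choose G hG using hex
  choose τ hτ using exists_mul_toCircle_eq
  -- The interior is rotation invariant, so a circle is either wholly inside it or misses it, and
  -- the two cases never mix on one circle. The origin is treated by the series too, as it may lie
  -- in `A` without being an interior point.
  set g : ℂ → ℂ := fun z => if z ∈ interior A ∨ z = 0 then ∑' n : ℤ, X.symbolCoeff M n * z ^ n
    else G ‖z‖ (τ z) with hg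
  have hseries : ∀ r : ℝ, (∀ t : UnitAddCircle,
      g ((r : ℂ) * (AddCircle.toCircle t : ℂ)) = ∑' n : ℤ, X.symbolCoeff M n *
        ((r : ℂ) * (AddCircle.toCircle t : ℂ)) ^ n) →
      (Summable fun n : ℤ => ‖X.symbolCoeff M n * (r : ℂ) ^ n‖) →
      MemLp (onCircle g r) ⊤ AddCircle.haarAddCircle ∧
        ∀ n : ℤ, fourierCoeff (onCircle g r) n = X.symbolCoeff M n * (r : ℂ) ^ n := by
    intro r h hs
    have : onCircle g r = fun t => ∑' n : ℤ, X.symbolCoeff M n * (r : ℂ) ^ n * fourier n t := by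
      funext t
      rw [onCircle, h]
      refine tsum_congr fun n => ?_
      rw [mul_zpow, fourier_eq_zpow, mul_assoc]
    rw [this]
    exact fourierCoeff_tsum hs
  refine ⟨g, fun z hz => ?_, fun r hr hrA => ?_⟩
  · simp only [hg, if_pos (Or.inl hz : z ∈ interior A ∨ z = 0)]
    exact (hA.summable hM hz).of_norm.hasSum
  by_cases hr0 : r = 0
  · subst hr0
    refine hseries 0 (fun t => ?_) ?_
    · simp [hg]
    · refine summable_of_ne_finset_zero (s := {0}) fun n hn => ?_
      rw [Complex.ofReal_zero, zero_zpow n (by simpa using hn), mul_zero, norm_zero]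
  by_cases hin : (r : ℂ) ∈ interior A
  · refine hseries r (fun t => ?_) (hA.summable hM hin)
    have : (r : ℂ) * (AddCircle.toCircle t : ℂ) ∈ interior A := by
      rw [mul_comm]; exact hA.interior_mul_mem hin (Circle.norm_coe _)
    simp only [hg, if_pos (Or.inl this : _ ∨ (r : ℂ) * (AddCircle.toCircle t : ℂ) = 0)]
  · have : onCircle g r = G r := by
      funext t
      have hr0' : (r : ℂ) ≠ 0 := by exact_mod_cast hr0
      have hn : ‖(r : ℂ) * (AddCircle.toCircle t : ℂ)‖ = r := by
        simpa using mul_toCircle_mem_sphere hr t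
      have hne : (r : ℂ) * (AddCircle.toCircle t : ℂ) ≠ 0 := mul_ne_zero hr0' (Circle.coe_ne_zero _)
      have hnot : ¬((r : ℂ) * (AddCircle.toCircle t : ℂ) ∈ interior A ∨
          (r : ℂ) * (AddCircle.toCircle t : ℂ) = 0) := by
        rintro (h | h)
        · apply hin
          have := hA.interior_mul_mem h (u := (AddCircle.toCircle t : ℂ)⁻¹)
            (by rw [norm_inv, Circle.norm_coe, inv_one])
          rwa [mul_comm (r : ℂ), inv_mul_cancel_left₀ (Circle.coe_ne_zero _)] at this
        · exact hne h
      have ht := hτ ((r : ℂ) * (AddCircle.toCircle t : ℂ))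
      simp only [onCircle, hg, if_neg hnot]
      rw [hn] at ht ⊢
      congr 1
      exact AddCircle.injective_toCircle one_ne_zero (Circle.coe_injective
        (mul_left_cancel₀ hr0' ht))
    rw [this]
    exact hG r hr hrA

end Domain

end SequenceSpace

theorem eq_zero_of_forall_mul_pow_le {a q B : ℝ} (ha : 0 ≤ a) (hq : 1 < q)
    (h : ∀ n : ℕ, a * q ^ n ≤ B) : a = 0 := by
  by_contra hne
  have hpos : 0 < a := lt_of_le_of_ne ha (Ne.symm hne)
  obtain ⟨n, hn⟩ := pow_unbounded_of_one_lt (B / a) hq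
  rw [div_lt_iff₀ hpos] at hn
  linarith [h n]

namespace SequenceSpace

variable {E : Type*} [NormedAddCommGroup E] [NormedSpace ℂ E] {X : SequenceSpace E}

/-! ### The spectrum of a bounded shift -/

/-- On the spectrum the Cesàro mean of a symbol is at most the norm of the corresponding
convolution, hence at most `K * ‖M‖`. At `0` the negative coefficients vanish because `S` is not
invertible. -/
theorem IsShift.isSymbolDomain [CompleteSpace E] (h1 : X.H1) (h2 : X.H2) (h3 : X.H3)
    {S : E →L[ℂ] E} (hS : X.IsShift S) : ∃ K, X.IsSymbolDomain (spectrum ℂ S) K := by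
  obtain ⟨K, hK, h⟩ := exists_isConvolution_cesaroCoeff h1 h2 h3
  refine ⟨K, hK, fun z hz u hu => hS.mul_mem_spectrum h1 h2 h3 hz hu, fun M hM k z hz => ?_,
    fun h0 M hM n hn => ?_⟩
  · obtain ⟨T, hT, hTn⟩ := h M hM k
    exact (hS.norm_sum_le h1 hT hz).trans hTn
  · obtain ⟨T, hT, -⟩ := h M hM n.natAbs
    have hu : ¬ IsUnit S := by
      have := spectrum.mem_iff.1 h0
      rw [map_zero, zero_sub, IsUnit.neg_iff] at this
      exact this
    have := hS.eq_zero_of_neg h1 hu hT hn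
    rw [cesaroCoeff_apply] at this
    exact (mul_eq_zero.1 this).resolve_left (by exact_mod_cast fejer_ne_zero n)

/-- The moduli of the points of the spectrum of a bounded shift form an interval. -/
theorem IsShift.mem_spectrum_of_norm_le [CompleteSpace E] (h1 : X.H1) (h2 : X.H2) (h3 : X.H3)
    {S : E →L[ℂ] E} (hS : X.IsShift S) {w₁ w₂ w : ℂ} (hw₁ : w₁ ∈ spectrum ℂ S)
    (hw₂ : w₂ ∈ spectrum ℂ S) (hle₁ : ‖w₁‖ ≤ ‖w‖) (hle₂ : ‖w‖ ≤ ‖w₂‖) : w ∈ spectrum ℂ S := by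
  obtain ⟨K, hK⟩ := hS.isSymbolDomain h1 h2 h3
  by_contra hw
  have hlt₁ : ‖w₁‖ < ‖w‖ := lt_of_le_of_ne hle₁ fun h =>
    hw (hK.sphere_subset hw₁ (by rw [mem_sphere_zero_iff_norm, h]))
  have hlt₂ : ‖w‖ < ‖w₂‖ := lt_of_le_of_ne hle₂ fun h =>
    hw (hK.sphere_subset hw₂ (by rw [mem_sphere_zero_iff_norm, h]))
  have hwpos : 0 < ‖w‖ := (norm_nonneg _).trans_lt hlt₁
  have hw0 : w ≠ 0 := norm_pos_iff.1 hwpos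
  obtain ⟨u, hu⟩ := spectrum.notMem_iff.1 hw
  set N : E →L[ℂ] E := ↑u⁻¹ with hN
  have hcomm : Commute N S := by
    have h : Commute S (u : E →L[ℂ] E) := by
      rw [hu]
      exact (show Commute S (algebraMap ℂ _ w) from (Algebra.commutes w S).symm).sub_right
        (Commute.refl S)
    exact h.units_inv_right.symm
  have hNm : X.IsMultiplier N := (hS.isMultiplier_iff h1).2 hcomm
  set y : ℤ → ℂ := X.symbolCoeff N with hy
  -- Coordinates of `(w - S) N e_0 = e_0`. Away from `n = 0` the sequence `y` is geometric on each
  -- side, so it is determined by `y 0` and `y (-1)`.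
  have hrec : ∀ n, w * y n - y (n - 1) = if n = 0 then 1 else 0 := by
    intro n
    have h : (algebraMap ℂ (E →L[ℂ] E) w - S) * N = 1 := by rw [← hu, hN, Units.mul_inv]
    have h' := congrArg (fun T : E →L[ℂ] E => X.coord (T X.e0) n) h
    rw [Algebra.algebraMap_eq_smul_one, sub_mul, smul_mul_assoc, one_mul] at h'
    change X.coord (w • N X.e0 - S (N X.e0)) n = X.coord X.e0 n at h'
    rw [map_sub, map_smul, Pi.sub_apply, Pi.smul_apply, hS.coord_apply, coord_e0_apply] at h'
    exact h'
  have hpos : ∀ n : ℕ, y n * w ^ n = y 0 := by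
    intro n
    induction n with
    | zero => simp
    | succ n ih =>
      have := hrec (n + 1)
      rw [if_neg (by omega), add_sub_cancel_right, sub_eq_zero] at this
      rw [pow_succ', ← mul_assoc]
      push_cast
      rw [mul_comm (y _), this, ih]
  have hneg : ∀ n : ℕ, y (-1 - n) = w ^ n * y (-1) := by
    intro n
    induction n with
    | zero => simp
    | succ n ih =>
      have := hrec (-1 - n)
      rw [if_neg (by omega), ih, sub_eq_zero, ← mul_assoc, ← pow_succ'] at this
      rw [this]
      congr 1
      push_cast
      ring
  -- The bound `‖y n‖ * ‖w₂‖ ^ n ≤ K * ‖N‖` would fail for large `n`, since `y n = y 0 * w ^ (-n)`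
  -- and `‖w‖ < ‖w₂‖`. The inner point `w₁` treats `y (-1)` in the same way.
  have hy0 : y 0 = 0 := by
    rw [← norm_eq_zero]
    refine eq_zero_of_forall_mul_pow_le (q := ‖w₂‖ / ‖w‖) (B := K * ‖N‖) (norm_nonneg _)
      ((one_lt_div hwpos).2 hlt₂) fun n => ?_
    have := hK.norm_symbolCoeff_le hNm hw₂ n
    rw [zpow_natCast] at this
    rw [← hpos n, norm_mul, norm_pow, div_pow, mul_assoc, mul_div_cancel₀ _ (pow_ne_zero _ hwpos.ne')]
    exact this
  have hy1 : y (-1) = 0 := by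
    by_cases hw10 : w₁ = 0
    · exact hK.coeff_eq_zero (hw10 ▸ hw₁) N hNm (-1) (by norm_num)
    have hw1p : 0 < ‖w₁‖ := norm_pos_iff.2 hw10
    rw [← norm_eq_zero]
    refine eq_zero_of_forall_mul_pow_le (q := ‖w‖ / ‖w₁‖) (B := K * ‖N‖ * ‖w₁‖) (norm_nonneg _)
      ((one_lt_div hw1p).2 hlt₁) fun n => ?_
    have := hK.norm_symbolCoeff_le hNm hw₁ (-1 - n)
    rw [← hy, hneg, norm_mul, norm_pow, sub_eq_add_neg, zpow_add₀ hw1p.ne', zpow_neg_one, zpow_neg,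
      zpow_natCast] at this
    calc ‖y (-1)‖ * (‖w‖ / ‖w₁‖) ^ n
        = ‖w‖ ^ n * ‖y (-1)‖ * (‖w₁‖⁻¹ * (‖w₁‖ ^ n)⁻¹) * ‖w₁‖ := by
          rw [div_pow]; field_simp
      _ ≤ _ := mul_le_mul_of_nonneg_right this hw1p.le
  have := hrec 0
  rw [if_pos rfl, hy0, zero_sub, hy1, mul_zero, sub_zero] at this
  exact zero_ne_one this

/-- Thus `S⁻¹`, if it is bounded, belongs to every algebra that contains the bounded convolutions.
-/
theorem IsShift.isConvolution_of_mul_eq_one {S : E →L[ℂ] E} (hS : X.IsShift S) {N : E →L[ℂ] E} (hN : S * N = 1) :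
    X.IsConvolution (Finsupp.single (-1) 1) N := by
  intro x n
  rw [Finsupp.sum_single_index (by simp), one_mul]
  have := congrArg (fun T : E →L[ℂ] E => X.coord (T x) (n + 1)) hN
  change X.coord (S (N x)) (n + 1) = X.coord x (n + 1) at this
  rw [hS.coord_apply, add_sub_cancel_right] at this
  rw [this, sub_neg_eq_add]

/-! ### Characters of a commutative algebra that contains the convolutions -/

section Characters

variable [CompleteSpace E] {S : E →L[ℂ] E} {𝔄 : Subalgebra ℂ (E →L[ℂ] E)}

/-- The norm of `γ a`, for a multiplicative functional `γ`, is at most the spectral radius. -/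
theorem exists_mem_spectrum_norm_apply_le [Nontrivial E] (h𝔄 : IsClosed (𝔄 : Set (E →L[ℂ] E)))
    (γ : 𝔄 →ₐ[ℂ] ℂ) (a : 𝔄) : ∃ v ∈ spectrum ℂ (a : E →L[ℂ] E), ‖γ a‖ ≤ ‖v‖ := by
  have : CompleteSpace 𝔄 := h𝔄.completeSpace_coe
  obtain ⟨v, hv, hvn⟩ := spectrum.exists_nnnorm_eq_spectralRadius (a : E →L[ℂ] E)
  refine ⟨v, hv, ?_⟩
  have h1 : γ a ∈ spectrum ℂ a := AlgHom.apply_mem_spectrum γ a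
  have h2 : (‖γ a‖₊ : ENNReal) ≤ spectralRadius ℂ a :=
    le_iSup₂ (f := fun (k : ℂ) (_ : k ∈ spectrum ℂ a) => (‖k‖₊ : ENNReal)) _ h1
  -- The spectrum in the subalgebra may be larger than that of the operator, but Gelfand's formula
  -- gives both the same radius.
  have h3 : spectralRadius ℂ a = spectralRadius ℂ (a : E →L[ℂ] E) :=
    tendsto_nhds_unique (spectrum.pow_nnnorm_pow_one_div_tendsto_nhds_spectralRadius a)
      (spectrum.pow_nnnorm_pow_one_div_tendsto_nhds_spectralRadius (a : E →L[ℂ] E))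
  rw [h3, ← hvn] at h2
  exact_mod_cast h2

/-- A multiplicative functional maps the shift to a point of its spectrum, and a convolution to the
value of its symbol there. -/
theorem IsShift.character_apply (h1 : X.H1) (h2 : X.H2) (h3 : X.H3) (hS : X.IsShift S)
    (h𝔄 : IsClosed (𝔄 : Set (E →L[ℂ] E)))
    (hconv : ∀ (φ : ℤ →₀ ℂ) (T : E →L[ℂ] E), X.IsConvolution φ T → T ∈ 𝔄) (γ : 𝔄 →ₐ[ℂ] ℂ) :
    ∃ w ∈ spectrum ℂ S, ∀ (φ : ℤ →₀ ℂ) (T : 𝔄), X.IsConvolution φ (T : E →L[ℂ] E) →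
      γ T = φ.sum fun k c => c * w ^ k := by
  have := X.nontrivial
  set s : 𝔄 := ⟨S, hconv _ S hS.isConvolution⟩ with hs
  have hinv : ∀ N : E →L[ℂ] E, S * N = 1 → ∃ n : 𝔄, (n : E →L[ℂ] E) = N ∧ γ s * γ n = 1 := by
    intro N hN
    refine ⟨⟨N, hconv _ N (hS.isConvolution_of_mul_eq_one hN)⟩, rfl, ?_⟩
    rw [← map_mul]
    exact (congrArg γ (Subtype.ext hN)).trans (map_one γ)
  refine ⟨γ s, ?_, fun φ T hT => ?_⟩
  -- `γ s` is known to lie in the spectrum relative to `𝔄` only. Its modulus is squeezed between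
  -- those of two points of `σ(S)`: the upper one from the spectral radius of `S`, the lower one
  -- from that of `S⁻¹`, or `0` if `S` is not invertible.
  · obtain ⟨w₂, hw₂, hle₂⟩ := exists_mem_spectrum_norm_apply_le h𝔄 γ s
    obtain ⟨w₁, hw₁, hle₁⟩ : ∃ w₁ ∈ spectrum ℂ S, ‖w₁‖ ≤ ‖γ s‖ := by
      by_cases hu : IsUnit S
      · obtain ⟨u, hu⟩ := hu
        obtain ⟨n, hn, hγ⟩ := hinv ↑u⁻¹ (by rw [← hu, Units.mul_inv])
        obtain ⟨v, hv, hle⟩ := exists_mem_spectrum_norm_apply_le h𝔄 γ n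
        rw [hn] at hv
        have hv0 : v ≠ 0 := spectrum.ne_zero_of_mem_of_unit hv
        refine ⟨v⁻¹, ?_, ?_⟩
        · have := (spectrum.inv_mem_iff (r := Units.mk0 v⁻¹ (inv_ne_zero hv0)) (a := u)).2 (by
            simpa using hv)
          rw [← hu]; exact this
        · rw [norm_inv, inv_le_comm₀ (norm_pos_iff.2 hv0) (norm_pos_iff.2 (left_ne_zero_of_mul_eq_one hγ)),
            ← norm_inv, inv_eq_of_mul_eq_one_right hγ]
          exact hle
      · refine ⟨0, ?_, by simp⟩
        rw [spectrum.mem_iff, map_zero, zero_sub, IsUnit.neg_iff]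
        exact hu
    exact hS.mem_spectrum_of_norm_le h1 h2 h3 hw₁ hw₂ hle₁ hle₂
  · have key : ∀ m : ℕ, (∀ n : ℤ, n < -m → φ n = 0) →
        γ s ^ m * γ T = (shiftedPoly φ m).eval (γ s) := by
      intro m hm
      have h := hS.pow_mul_eq_aeval hT hm
      have h' : s ^ m * T = Polynomial.aeval s (shiftedPoly φ m) := by
        refine Subtype.ext ?_
        exact h.trans (Polynomial.aeval_algHom_apply 𝔄.val s (shiftedPoly φ m))
      rw [← map_pow, ← map_mul, h', ← Polynomial.aeval_algHom_apply, Polynomial.coe_aeval_eq_eval]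
    by_cases hw0 : γ s = 0
    · have hu : ¬ IsUnit S := by
        rintro ⟨u, hu⟩
        obtain ⟨n, -, hγ⟩ := hinv ↑u⁻¹ (by rw [← hu, Units.mul_inv])
        exact left_ne_zero_of_mul_eq_one hγ hw0
      have hm : ∀ n : ℤ, n < -(0 : ℕ) → φ n = 0 := fun n hn =>
        hS.eq_zero_of_neg h1 hu hT (by simpa using hn)
      have := key 0 hm
      simp only [eval_shiftedPoly hm (Or.inr rfl), pow_zero, one_mul] at this
      exact this
    · obtain ⟨m, hm⟩ := exists_neg_bound φ
      have := key m hm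
      rw [eval_shiftedPoly hm (Or.inl hw0)] at this
      exact mul_left_cancel₀ (pow_ne_zero _ hw0) this

end Characters

/-! ### Reflection of sequences -/

variable (X) in
/-- The sequence space with the order of `ℤ` reversed. -/
def reflect : SequenceSpace E where
  coord := LinearMap.funLeft ℂ ℂ (fun n : ℤ => -n) ∘ₗ X.coord
  coord_injective := by
    intro x y h
    refine coord_ext (X := X) fun n => ?_
    have := congrFun h (-n)
    simpa [LinearMap.funLeft_apply] using this
  finite_mem := by
    intro a ha
    obtain ⟨x, hx⟩ := X.finite_mem (fun n => a (-n)) (ha.preimage neg_injective.injOn)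
    refine ⟨x, funext fun n => ?_⟩
    change X.coord x (-n) = a n
    simp only [hx, neg_neg]

theorem coord_reflect (x : E) (n : ℤ) : X.reflect.coord x n = X.coord x (-n) := rfl

theorem mem_finiteSeq_reflect {x : E} : x ∈ X.reflect.finiteSeq ↔ x ∈ X.finiteSeq := by
  constructor
  · intro h
    have h' : (X.reflect.coord x).support.Finite := h
    refine (h'.preimage (f := fun n : ℤ => -n) neg_injective.injOn).subset fun n hn => ?_
    change X.coord x (- -n) ≠ 0
    rwa [neg_neg]
  · intro h
    exact Set.Finite.preimage (f := fun n : ℤ => -n) neg_injective.injOn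
      (show (X.coord x).support.Finite from h)

theorem H1.reflect (h1 : X.H1) : X.reflect.H1 := by
  have : (X.reflect.finiteSeq : Set E) = X.finiteSeq := Set.ext fun _ => mem_finiteSeq_reflect
  unfold H1
  rwa [this]

theorem H2.reflect (h2 : X.H2) : X.reflect.H2 := fun n => h2 (-n)

theorem H3.reflect (h3 : X.H3) : X.reflect.H3 := by
  obtain ⟨h, C, hC⟩ := h3
  have hz' : ∀ z : ℂ, ‖z‖ = 1 → ‖z⁻¹‖ = 1 := fun z hz => by rw [norm_inv, hz, inv_one]
  refine ⟨fun z hz x => ?_, C, fun z hz x y hxy => hC z⁻¹ (hz' z hz) x y (funext fun n => ?_)⟩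
  · obtain ⟨y, hy⟩ := h z⁻¹ (hz' z hz) x
    refine ⟨y, funext fun n => ?_⟩
    simp only [coord_reflect, hy, inv_zpow, zpow_neg, inv_inv]
  · have := congrFun hxy (-n)
    simp only [coord_reflect, neg_neg] at this
    rw [this, inv_zpow, zpow_neg]

theorem ShiftInvBounded.reflect (h : X.ShiftInvBounded) : X.reflect.ShiftBounded := by
  intro x
  obtain ⟨y, hy⟩ := h x
  refine ⟨y, funext fun n => ?_⟩
  rw [coord_reflect, hy, seqShiftInv_apply, seqShift_apply, coord_reflect]
  ring_nf

theorem e0_reflect : X.reflect.e0 = X.e0 := by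
  refine coord_ext (X := X) fun n => ?_
  have h := coord_e0_apply X.reflect (-n)
  rw [coord_reflect, neg_neg] at h
  simp only [h, coord_e0_apply, neg_eq_zero]

theorem symbolCoeff_reflect (M : E →L[ℂ] E) (n : ℤ) :
    X.reflect.symbolCoeff M n = X.symbolCoeff M (-n) := by
  rw [symbolCoeff, symbolCoeff, e0_reflect, coord_reflect]

theorem IsMultiplier.reflect {M : E →L[ℂ] E} (hM : X.IsMultiplier M) :
    X.reflect.IsMultiplier M := by
  intro a b ha hb
  have e : X.coord a = seqShift (X.coord b) := by
    ext n
    have := congrFun hb (-n + 1)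
    simp only [coord_reflect, seqShift_apply, add_sub_cancel_right, neg_neg] at this
    rw [seqShift_apply, ← this]
    ring_nf
  have hbf : b ∈ X.finiteSeq := by
    have : (X.coord a).support.Finite := mem_finiteSeq_reflect.1 ha
    rw [e] at this
    refine (this.preimage (f := fun n : ℤ => n + 1) (add_left_injective 1).injOn).subset fun n hn => ?_
    change seqShift (X.coord b) (n + 1) ≠ 0
    rw [seqShift_apply, add_sub_cancel_right]
    exact hn
  have h := hM b a hbf e
  ext n
  rw [seqShift_apply, coord_reflect, coord_reflect, h, seqShift_apply]
  ring_nf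

theorem reflect_reflect : X.reflect.reflect = X := by
  have : X.reflect.reflect.coord = X.coord := by
    ext x n
    rw [coord_reflect, coord_reflect, neg_neg]
  cases X
  simp only [reflect] at this ⊢
  congr

theorem isMultiplier_reflect {M : E →L[ℂ] E} : X.reflect.IsMultiplier M ↔ X.IsMultiplier M :=
  ⟨fun h => by simpa only [reflect_reflect] using h.reflect, IsMultiplier.reflect⟩

theorem IsConvolution.reflect {φ : ℤ →₀ ℂ} {T : E →L[ℂ] E} (hT : X.IsConvolution φ T) :
    X.reflect.IsConvolution (φ.mapDomain (fun n => -n)) T := by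
  intro x n
  rw [Finsupp.sum_mapDomain_index (by simp) (by intros; ring), coord_reflect, hT]
  refine Finsupp.sum_congr fun k _ => ?_
  rw [coord_reflect]
  ring_nf

theorem cesaroCoeff_reflect_sum (M : E →L[ℂ] E) (k : ℕ) (z : ℂ) :
    ((X.reflect.cesaroCoeff M k).sum fun n c => c * z⁻¹ ^ n) =
      (X.cesaroCoeff M k).sum fun n c => c * z ^ n := by
  rw [cesaroCoeff_sum, cesaroCoeff_sum]
  refine Finset.sum_equiv (Equiv.neg ℤ) (fun n => ?_) fun n _ => ?_
  · simp only [Finset.mem_Icc, Equiv.neg_apply]; omega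
  · rw [symbolCoeff_reflect, inv_zpow', Equiv.neg_apply]
    congr 3
    simp [fejer]

/-- Reversing the order of `ℤ` replaces `z` by `z⁻¹` in the symbols. Since `0` is excluded, the
condition on negative coefficients is void. -/
theorem IsSymbolDomain.reflect {A : Set ℂ} {K : ℝ} (hA : X.reflect.IsSymbolDomain A K) :
    X.IsSymbolDomain {z | z ≠ 0 ∧ z⁻¹ ∈ A} K where
  const_nonneg := hA.const_nonneg
  mul_mem := fun z hz u hu => by
    refine ⟨mul_ne_zero (fun h => ?_) hz.1, ?_⟩
    · rw [h] at hu; simp at hu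
    · rw [mul_inv]
      exact hA.mul_mem _ hz.2 _ (by rw [norm_inv, hu, inv_one])
  norm_sum_le := fun M hM k z hz => by
    rw [← cesaroCoeff_reflect_sum]
    exact hA.norm_sum_le M hM.reflect k _ hz.2
  coeff_eq_zero := fun h => absurd rfl h.1

/-! ### The spectrum of the shift -/

theorem mem_shift_domain {x : E} : x ∈ X.shift.domain ↔ ∃ y, X.coord y = seqShift (X.coord x) :=
  Iff.rfl

theorem IsShift.shiftSpectrum_eq {S : E →L[ℂ] E} (hS : X.IsShift S) :
    X.shiftSpectrum = spectrum ℂ S := by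
  have hb : X.ShiftBounded := fun x => ⟨S x, hS x⟩
  have hdom : ∀ x, x ∈ X.shift.domain := fun x => mem_shift_domain.2 ⟨S x, hS x⟩
  have hval : ∀ x : X.shift.domain, X.shift x = S x := fun x =>
    X.coord_injective (by rw [X.coord_shift, hS])
  rw [shiftSpectrum, shiftOperator, if_pos hb]
  ext z
  change (¬ _) ↔ z ∈ spectrum ℂ S
  rw [spectrum.mem_iff, not_iff_not]
  constructor
  · rintro ⟨R, hR1, hR2⟩
    have e1 : R * (S - algebraMap ℂ _ z) = 1 := by
      ext x
      have := hR1 ⟨x, hdom x⟩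
      rw [hval] at this
      rw [Algebra.algebraMap_eq_smul_one]
      exact this
    have e2 : (S - algebraMap ℂ _ z) * R = 1 := by
      ext y
      obtain ⟨h, hy⟩ := hR2 y
      rw [hval] at hy
      rw [Algebra.algebraMap_eq_smul_one]
      exact hy
    rw [← IsUnit.neg_iff, neg_sub]
    exact ⟨⟨_, R, e2, e1⟩, rfl⟩
  · intro hu
    rw [← IsUnit.neg_iff, neg_sub] at hu
    obtain ⟨u, hu⟩ := hu
    refine ⟨↑u⁻¹, fun x => ?_, fun y => ⟨hdom _, ?_⟩⟩
    · rw [hval]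
      have : (↑u⁻¹ * ↑u : E →L[ℂ] E) (x : E) = x := by rw [Units.inv_mul]; rfl
      rw [hu, Algebra.algebraMap_eq_smul_one] at this
      exact this
    · rw [hval]
      have : (↑u * ↑u⁻¹ : E →L[ℂ] E) y = y := by rw [Units.mul_inv]; rfl
      rw [hu, Algebra.algebraMap_eq_smul_one] at this
      exact this

/-- The reflected shift `T` is `S⁻¹`, so the graph of `S` is the transposed graph of a bounded
operator; in particular it is closed. -/
theorem coord_eq_seqShift_iff {T : E →L[ℂ] E} (hT : X.reflect.IsShift T) {x y : E} :
    X.coord y = seqShift (X.coord x) ↔ x = T y := by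
  have h : ∀ n, X.coord (T y) n = X.coord y (n + 1) := fun n => by
    have := hT.coord_apply y (-n)
    rw [coord_reflect, coord_reflect, neg_neg] at this
    rw [this]; ring_nf
  constructor
  · intro hy
    refine coord_ext (X := X) fun n => ?_
    rw [h, hy, seqShift_apply, add_sub_cancel_right]
  · rintro rfl
    ext n
    rw [seqShift_apply, h, sub_add_cancel]

theorem mem_shift_graph_iff {x y : E} : (x, y) ∈ X.shift.graph ↔ X.coord y = seqShift (X.coord x) := by
  rw [LinearPMap.mem_graph_iff]
  constructor
  · rintro ⟨u, hu, hy⟩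
    simp only at hu hy
    rw [← hy, ← hu, X.coord_shift]
  · intro h
    exact ⟨⟨x, mem_shift_domain.2 ⟨y, h⟩⟩, rfl, X.coord_injective (by rw [X.coord_shift, h])⟩

/-- If the inverse of the shift is bounded, then the smallest closed extension of the shift on the
finitely supported sequences is the shift with its maximal domain. -/
theorem closure_shiftFinite (h1 : X.H1) {T : E →L[ℂ] E} (hT : X.reflect.IsShift T) :
    X.shiftFinite.closure = X.shift := by
  have hgraph : X.shiftFinite.graph.topologicalClosure = X.shift.graph := by
    refine le_antisymm ?_ ?_
    · refine Submodule.topologicalClosure_minimal _ ?_ ?_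
      · rintro ⟨x, y⟩ hxy
        rw [LinearPMap.mem_graph_iff] at hxy
        obtain ⟨u, hu, hy⟩ := hxy
        simp only at hu hy
        refine mem_shift_graph_iff.2 ?_
        have e : X.shiftFinite u = X.shift ⟨u, u.2.2⟩ := LinearPMap.domRestrict_apply rfl
        rw [← hy, ← hu, e, X.coord_shift]
      · have : (X.shift.graph : Set (E × E)) = {p | p.1 = T p.2} := by
          ext ⟨x, y⟩
          exact mem_shift_graph_iff.trans (coord_eq_seqShift_iff hT)
        rw [this]
        exact isClosed_eq continuous_fst (T.continuous.comp continuous_snd)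
    -- The graph of `S` consists of the pairs `(T y, y)`. For finitely supported `y` they lie in the
    -- graph of the restriction, and such `y` are dense.
    · rintro ⟨x, y⟩ hxy
      obtain rfl := (coord_eq_seqShift_iff hT).1 (mem_shift_graph_iff.1 hxy)
      clear hxy
      revert y
      refine h1.induction (p := fun y => (T y, y) ∈ X.shiftFinite.graph.topologicalClosure)
        ((Submodule.isClosed_topologicalClosure _).preimage
          (T.continuous.prodMk continuous_id)) fun y hy => ?_
      refine Submodule.le_topologicalClosure _ ?_
      have hd : T y ∈ X.shift.domain :=
        mem_shift_domain.2 ⟨y, (coord_eq_seqShift_iff hT).2 rfl⟩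
      have hf : T y ∈ X.finiteSeq :=
        mem_finiteSeq_reflect.1 (hT.mem_finiteSeq (mem_finiteSeq_reflect.2 hy))
      rw [LinearPMap.mem_graph_iff]
      refine ⟨⟨T y, hf, hd⟩, rfl, ?_⟩
      have e : X.shiftFinite ⟨T y, hf, hd⟩ = X.shift ⟨T y, hd⟩ := LinearPMap.domRestrict_apply rfl
      refine X.coord_injective ?_
      rw [e, X.coord_shift]
      exact ((coord_eq_seqShift_iff hT).2 rfl).symm
  have hc : X.shiftFinite.IsClosable := ⟨X.shift, hgraph⟩
  refine LinearPMap.eq_of_eq_graph ?_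
  rw [← hc.graph_closure_eq_closure_graph, hgraph]

/-- If only the inverse `T` of the shift is bounded, then `σ(S)` consists of the inverses of the
points of `σ(T)`. -/
theorem shiftSpectrum_eq_of_not_shiftBounded (h1 : X.H1) (hb : ¬ X.ShiftBounded) {T : E →L[ℂ] E}
    (hT : X.reflect.IsShift T) : X.shiftSpectrum = {z | z ≠ 0 ∧ z⁻¹ ∈ spectrum ℂ T} := by
  have hdom : ∀ y, T y ∈ X.shift.domain := fun y =>
    mem_shift_domain.2 ⟨y, (coord_eq_seqShift_iff hT).2 rfl⟩
  have hval : ∀ y, X.shift ⟨T y, hdom y⟩ = y := fun y => X.coord_injective (by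
    rw [X.coord_shift]
    exact ((coord_eq_seqShift_iff hT).2 rfl).symm)
  have hTs : ∀ x : X.shift.domain, T (X.shift x) = x := fun x =>
    ((coord_eq_seqShift_iff hT).1 (X.coord_shift x)).symm
  rw [shiftSpectrum, shiftOperator, if_neg hb, closure_shiftFinite h1 hT]
  ext z
  change (¬ _) ↔ z ≠ 0 ∧ z⁻¹ ∈ spectrum ℂ T
  by_cases hz : z = 0
  · subst hz
    simp only [ne_eq, not_true_eq_false, false_and, iff_false, not_not]
    refine ⟨T, fun x => ?_, fun y => ⟨hdom y, ?_⟩⟩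
    · rw [zero_smul, sub_zero, hTs]
    · rw [zero_smul, sub_zero, hval]
  have hsmul : ∀ x : E, (algebraMap ℂ (E →L[ℂ] E) z⁻¹ - T) x = z⁻¹ • x - T x := fun x => by
    rw [Algebra.algebraMap_eq_smul_one]; rfl
  rw [and_iff_right hz, spectrum.mem_iff, not_iff_not]
  constructor
  · rintro ⟨R, hR1, hR2⟩
    have hT1 : ∀ y, R (y - z • T y) = T y := fun y => by
      have := hR1 ⟨T y, hdom y⟩
      rwa [hval] at this
    have hT2 : ∀ y, T y = R y - z • T (R y) := fun y => by
      obtain ⟨h, hy⟩ := hR2 y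
      have := congrArg T hy
      rw [map_sub, hTs, map_smul] at this
      exact this.symm
    -- Formally `z⁻¹ - T = z⁻¹ T (S - z)`, with inverse `z R S = z (1 + z R)`, a bounded expression.
    -- Conversely, `(S - z)⁻¹ = z⁻¹ T (z⁻¹ - T)⁻¹`.
    refine ⟨⟨algebraMap ℂ _ z⁻¹ - T, z • (1 + z • R), ?_, ?_⟩, rfl⟩
    · ext y
      change (algebraMap ℂ (E →L[ℂ] E) z⁻¹ - T) (z • (y + z • R y)) = y
      rw [map_smul, hsmul, map_add, map_smul, hT2 y]
      simp only [smul_sub, smul_add, smul_smul, mul_inv_cancel₀ hz, one_smul,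
        mul_inv_cancel_left₀ hz]
      abel
    · ext y
      change z • ((algebraMap ℂ (E →L[ℂ] E) z⁻¹ - T) y +
        z • R ((algebraMap ℂ (E →L[ℂ] E) z⁻¹ - T) y)) = y
      have e : z • R ((algebraMap ℂ (E →L[ℂ] E) z⁻¹ - T) y) = T y := by
        rw [← map_smul, hsmul, smul_sub, smul_smul, mul_inv_cancel₀ hz, one_smul, hT1]
      rw [e, hsmul, sub_add_cancel, smul_smul, mul_inv_cancel₀ hz, one_smul]
  · rintro ⟨u, hu⟩
    set Q : E →L[ℂ] E := ↑u⁻¹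
    have hQ1 : ∀ y, z⁻¹ • Q y - T (Q y) = y := fun y => by
      rw [← hsmul, ← hu]
      change (↑u * ↑u⁻¹ : E →L[ℂ] E) y = y
      rw [Units.mul_inv]; rfl
    have hQ2 : ∀ y, Q (z⁻¹ • y - T y) = y := fun y => by
      rw [← hsmul, ← hu]
      change (↑u⁻¹ * ↑u : E →L[ℂ] E) y = y
      rw [Units.inv_mul]; rfl
    refine ⟨z⁻¹ • (T * Q), fun x => ?_, fun y => ?_⟩
    · change z⁻¹ • T (Q (X.shift x - z • (x : E))) = x
      have e : X.shift x - z • (x : E) = z • (z⁻¹ • X.shift x - T (X.shift x)) := by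
        rw [hTs, smul_sub, smul_smul, mul_inv_cancel₀ hz, one_smul]
      rw [e, map_smul, hQ2, map_smul, hTs, smul_smul, inv_mul_cancel₀ hz, one_smul]
    · have hd : (z⁻¹ • (T * Q)) y = T (z⁻¹ • Q y) := by
        rw [map_smul]; rfl
      refine ⟨hd ▸ hdom _, ?_⟩
      have e : X.shift ⟨(z⁻¹ • (T * Q)) y, hd ▸ hdom _⟩ = z⁻¹ • Q y :=
        (congrArg (fun v : X.shift.domain => X.shift v) (Subtype.ext hd)).trans (hval (z⁻¹ • Q y))
      rw [e, hd, map_smul, smul_smul, mul_inv_cancel₀ hz, one_smul, hQ1]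

end SequenceSpace

/-! ### The essential range -/

/-- Each point of `U` has a neighbourhood with null preimage, and by the Lindelöf property countably
many of them cover `U`. -/
theorem measure_preimage_eq_zero_of_disjoint_essentialRange {α : Type*} [MeasurableSpace α]
    {μ : Measure α} {f : α → ℂ} {U : Set ℂ} (hU : Disjoint U (essentialRange μ f)) :
    μ (f ⁻¹' U) = 0 := by
  have h : ∀ w ∈ U, ∃ V ∈ 𝓝 w, μ (f ⁻¹' V) = 0 := by
    intro w hw
    by_contra hcon
    push Not at hcon
    exact Set.disjoint_left.1 hU hw hcon
  choose! V hV hV0 using h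
  obtain ⟨t, htU, htc, hcov⟩ := TopologicalSpace.countable_cover_nhdsWithin (f := V) (s := U)
    fun w hw => mem_nhdsWithin_of_mem_nhds (hV w hw)
  refine measure_mono_null (Set.preimage_mono hcov) ?_
  rw [Set.preimage_iUnion₂, measure_biUnion_null_iff htc]
  exact fun w hw => hV0 w (htU hw)

theorem notMem_closure_circularEssRange {g : ℂ → ℂ} {A : Set ℂ} {l : ℂ} {δ : ℝ} (hδ : 0 < δ)
    (h : ∀ r : ℝ, 0 ≤ r → Metric.sphere (0 : ℂ) r ⊆ A →
      ∀ᵐ t ∂AddCircle.haarAddCircle, δ ≤ ‖onCircle g r t - l‖) :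
    l ∉ closure (circularEssRange g A) := by
  intro hl
  obtain ⟨w, ⟨r, hr, hrA, hw⟩, hlw⟩ := Metric.mem_closure_iff.1 hl δ hδ
  refine hw (Metric.ball l δ) (Metric.isOpen_ball.mem_nhds (by rwa [Metric.mem_ball, dist_comm])) ?_
  rw [measure_eq_zero_iff_ae_notMem]
  filter_upwards [h r hr hrA] with t ht hmem
  rw [Set.mem_preimage, Metric.mem_ball, dist_eq_norm] at hmem
  linarith

namespace SequenceSpace

variable {E : Type*} [NormedAddCommGroup E] [NormedSpace ℂ E] {X : SequenceSpace E}

/-! ### Resolvents of multipliers -/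

/-- Multipliers are the operators commuting with whichever of `S` and `S⁻¹` is bounded, and
commutation passes to inverses. -/
theorem IsMultiplier.exists_resolvent [CompleteSpace E] (h1 : X.H1) (h2 : X.H2)
    (hS : X.ShiftBounded ∨ X.ShiftInvBounded) {M : E →L[ℂ] E} (hM : X.IsMultiplier M) {l : ℂ}
    (hl : l ∉ spectrum ℂ M) : ∃ N : E →L[ℂ] E, X.IsMultiplier N ∧ M * N = 1 + l • N := by
  obtain ⟨u, hu⟩ := spectrum.notMem_iff.1 hl
  refine ⟨-↑u⁻¹, ?_, ?_⟩
  · have key : ∀ S : E →L[ℂ] E, Commute M S → Commute (-↑u⁻¹ : E →L[ℂ] E) S := by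
      intro S h
      have : Commute S (u : E →L[ℂ] E) := by
        rw [hu]
        exact (show Commute S (algebraMap ℂ _ l) from (Algebra.commutes l S).symm).sub_right h.symm
      exact this.units_inv_right.symm.neg_left
    rcases hS with hS | hS
    · obtain ⟨S, hS⟩ := hS.exists_isShift h2
      exact (hS.isMultiplier_iff h1).2 (key S ((hS.isMultiplier_iff h1).1 hM))
    · obtain ⟨S, hS⟩ := hS.reflect.exists_isShift h2.reflect
      exact isMultiplier_reflect.1 ((hS.isMultiplier_iff h1.reflect).2
        (key S ((hS.isMultiplier_iff h1.reflect).1 hM.reflect)))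
  · have h : (algebraMap ℂ (E →L[ℂ] E) l - M) * ↑u⁻¹ = 1 := by rw [← hu, Units.mul_inv]
    rw [Algebra.algebraMap_eq_smul_one, sub_mul, smul_mul_assoc, one_mul] at h
    rw [mul_neg, smul_neg, ← h]
    abel

theorem exists_isSymbolDomain [CompleteSpace E] (h1 : X.H1) (h2 : X.H2) (h3 : X.H3)
    (hS : X.ShiftBounded ∨ X.ShiftInvBounded) : ∃ K, X.IsSymbolDomain X.shiftSpectrum K := by
  by_cases hb : X.ShiftBounded
  · obtain ⟨S, hS⟩ := hb.exists_isShift h2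
    rw [hS.shiftSpectrum_eq]
    exact hS.isSymbolDomain h1 h2 h3
  · obtain ⟨T, hT⟩ := (hS.resolve_left hb).reflect.exists_isShift h2.reflect
    obtain ⟨K, hK⟩ := hT.isSymbolDomain h1.reflect h2.reflect h3.reflect
    rw [shiftSpectrum_eq_of_not_shiftBounded h1 hb hT]
    exact ⟨K, hK.reflect⟩

/-! ### The algebra of convolutions -/

theorem IsConvolution.mem_finiteSeq {φ : ℤ →₀ ℂ} {T : E →L[ℂ] E} (hT : X.IsConvolution φ T) {a : E}
    (ha : a ∈ X.finiteSeq) : T a ∈ X.finiteSeq := by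
  obtain ⟨b, hb, hbc⟩ := exists_coord_eq_seqConv φ ha
  have : T a = b := coord_ext (X := X) fun n => by rw [hT, hbc, seqConv_apply]
  rwa [this]

theorem IsConvolution.commute {φ χ : ℤ →₀ ℂ} {T U : E →L[ℂ] E} (hT : X.IsConvolution φ T)
    (hU : X.IsConvolution χ U) : Commute T U := by
  ext x
  refine coord_ext (X := X) fun n => ?_
  change X.coord (T (U x)) n = X.coord (U (T x)) n
  rw [hT, hU]
  simp only [hT x, hU x, Finsupp.sum, Finset.mul_sum]
  rw [Finset.sum_comm]
  refine Finset.sum_congr rfl fun k _ => Finset.sum_congr rfl fun j _ => ?_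
  rw [sub_right_comm]
  ring

theorem IsConvolution.exists_mul (h1 : X.H1) (h2 : X.H2) {φ χ : ℤ →₀ ℂ} {T U : E →L[ℂ] E}
    (hT : X.IsConvolution φ T) (hU : X.IsConvolution χ U) : ∃ ρ, X.IsConvolution ρ (T * U) := by
  have hm : X.IsMultiplier (T * U) := fun a b ha hb =>
    hT.isMultiplier _ _ (hU.mem_finiteSeq ha) (hU.isMultiplier a b ha hb)
  have hf : (X.symbolCoeff (T * U)).support.Finite := hT.mem_finiteSeq (hU.mem_finiteSeq X.e0_mem)
  exact ⟨Finsupp.ofSupportFinite _ hf, hm.isConvolution h1 h2 fun n => rfl⟩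

/-- The bounded convolutions already form an algebra, so generating one adds nothing. -/
theorem exists_isConvolution_of_mem_adjoin (h1 : X.H1) (h2 : X.H2) {P : E →L[ℂ] E}
    (hP : P ∈ Algebra.adjoin ℂ {T : E →L[ℂ] E | ∃ φ : ℤ →₀ ℂ, X.IsConvolution φ T}) :
    ∃ φ, X.IsConvolution φ P := by
  induction hP using Algebra.adjoin_induction with
  | mem T hT => exact hT
  | algebraMap c =>
    refine ⟨Finsupp.single 0 c, fun x n => ?_⟩
    rw [Finsupp.sum_single_index (by simp), sub_zero, Algebra.algebraMap_eq_smul_one]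
    change X.coord (c • x) n = _
    rw [map_smul, Pi.smul_apply, smul_eq_mul]
  | add T U _ _ hT hU =>
    obtain ⟨φ, hT⟩ := hT
    obtain ⟨χ, hU⟩ := hU
    refine ⟨φ + χ, fun x n => ?_⟩
    rw [Finsupp.sum_add_index' (by simp) (by intros; ring), ← hT, ← hU, _root_.add_apply, map_add,
      Pi.add_apply]
  | mul T U _ _ hT hU =>
    obtain ⟨φ, hT⟩ := hT
    obtain ⟨χ, hU⟩ := hU
    exact hT.exists_mul h1 h2 hU

theorem IsConvolution.mem_convolutionAlgebra {φ : ℤ →₀ ℂ} {T : E →L[ℂ] E}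
    (hT : X.IsConvolution φ T) : T ∈ X.convolutionAlgebra :=
  Subalgebra.le_topologicalClosure _ (Algebra.subset_adjoin ⟨φ, hT⟩)

theorem isMultiplier_of_mem_convolutionAlgebra (h1 : X.H1) (h2 : X.H2) {M : E →L[ℂ] E}
    (hM : M ∈ X.convolutionAlgebra) : X.IsMultiplier M := by
  have hclosed : IsClosed {M : E →L[ℂ] E | X.IsMultiplier M} := by
    have : {M : E →L[ℂ] E | X.IsMultiplier M} = ⋂ (a : E) (b : E) (_ : a ∈ X.finiteSeq)
        (_ : X.coord b = seqShift (X.coord a)) (n : ℤ),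
        {M : E →L[ℂ] E | X.coord (M b) n = X.coord (M a) (n - 1)} := by
      ext M
      simp only [Set.mem_iInter, Set.mem_ofPred_eq, IsMultiplier, funext_iff, seqShift_apply]
    rw [this]
    refine isClosed_iInter fun a => isClosed_iInter fun b => isClosed_iInter fun _ =>
      isClosed_iInter fun _ => isClosed_iInter fun n => ?_
    exact isClosed_eq ((h2 n).comp (ContinuousLinearMap.apply ℂ E b).continuous)
      ((h2 (n - 1)).comp (ContinuousLinearMap.apply ℂ E a).continuous)
  refine closure_minimal (fun P hP => ?_) hclosed hM
  obtain ⟨φ, hφ⟩ := exists_isConvolution_of_mem_adjoin h1 h2 hP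
  exact hφ.isMultiplier

theorem convolutionAlgebra_mul_comm (h1 : X.H1) (h2 : X.H2) (a b : X.convolutionAlgebra) :
    a * b = b * a := by
  have hs : ∀ x y : Algebra.adjoin ℂ {T : E →L[ℂ] E | ∃ φ : ℤ →₀ ℂ, X.IsConvolution φ T},
      x * y = y * x := by
    intro x y
    obtain ⟨φ, hφ⟩ := exists_isConvolution_of_mem_adjoin h1 h2 x.2
    obtain ⟨χ, hχ⟩ := exists_isConvolution_of_mem_adjoin h1 h2 y.2
    exact Subtype.ext (hφ.commute hχ)
  exact (Subalgebra.commRingTopologicalClosure _ hs).mul_comm a b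

/-- An element with no inverse among all operators has none in `𝔖`, and in a commutative Banach
algebra every nonunit is annihilated by a character. -/
theorem exists_character_apply_eq [CompleteSpace E] (h1 : X.H1) (h2 : X.H2) {M : E →L[ℂ] E}
    (hM : M ∈ X.convolutionAlgebra) {l : ℂ} (hl : l ∈ spectrum ℂ M) :
    ∃ γ : X.convolutionAlgebra →ₐ[ℂ] ℂ, γ ⟨M, hM⟩ = l := by
  have hc : IsClosed (X.convolutionAlgebra : Set (E →L[ℂ] E)) :=
    Subalgebra.isClosed_topologicalClosure _
  have : CompleteSpace X.convolutionAlgebra := hc.completeSpace_coe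
  let : NormedCommRing X.convolutionAlgebra :=
    { (inferInstance : NormedRing X.convolutionAlgebra) with
      mul_comm := convolutionAlgebra_mul_comm h1 h2 }
  set a : X.convolutionAlgebra := algebraMap ℂ _ l - ⟨M, hM⟩ with ha
  have hu : ¬ IsUnit a := fun h => spectrum.mem_iff.1 hl (by
    have := h.map X.convolutionAlgebra.val
    rw [ha, map_sub] at this
    exact this)
  obtain ⟨f, hf⟩ := WeakDual.CharacterSpace.exists_apply_eq_zero hu
  refine ⟨WeakDual.CharacterSpace.toAlgHom f, ?_⟩
  have h : WeakDual.CharacterSpace.toAlgHom f a = 0 := hf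
  rw [ha, map_sub, AlgHom.commutes, sub_eq_zero] at h
  exact h.symm

/-- The values of a multiplicative functional at convolutions are approximated by values of the
symbols on `σ(S)`. -/
theorem exists_norm_character_sub_lt [CompleteSpace E] (h1 : X.H1) (h2 : X.H2) (h3 : X.H3)
    (hS : X.ShiftBounded ∨ X.ShiftInvBounded) (hne : X.shiftSpectrum.Nonempty)
    (γ : X.convolutionAlgebra →ₐ[ℂ] ℂ) {φ : ℤ →₀ ℂ} {P : E →L[ℂ] E} (hP : X.IsConvolution φ P)
    {ε : ℝ} (hε : 0 < ε) : ∃ z ∈ X.shiftSpectrum,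
      ‖γ ⟨P, hP.mem_convolutionAlgebra⟩ - φ.sum fun k c => c * z ^ k‖ < ε := by
  have hc : IsClosed (X.convolutionAlgebra : Set (E →L[ℂ] E)) :=
    Subalgebra.isClosed_topologicalClosure _
  by_cases hb : X.ShiftBounded
  · obtain ⟨S, hS⟩ := hb.exists_isShift h2
    obtain ⟨w, hw, hγ⟩ := hS.character_apply h1 h2 h3 hc
      (fun φ T hT => hT.mem_convolutionAlgebra) γ
    refine ⟨w, by rwa [hS.shiftSpectrum_eq], ?_⟩
    rw [hγ φ _ hP, sub_self, norm_zero]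
    exact hε
  · obtain ⟨T, hT⟩ := (hS.resolve_left hb).reflect.exists_isShift h2.reflect
    obtain ⟨w, hw, hγ⟩ := hT.character_apply h1.reflect h2.reflect h3.reflect hc
      (fun φ T hT => by
        have := hT.reflect
        rw [reflect_reflect] at this
        exact this.mem_convolutionAlgebra) γ
    set χ : ℤ →₀ ℂ := φ.mapDomain (fun n => -n) with hχ
    have hsum : ∀ v : ℂ, (φ.sum fun k c => c * v⁻¹ ^ k) = χ.sum fun k c => c * v ^ k := by
      intro v
      rw [hχ, Finsupp.sum_mapDomain_index (by simp) (by intros; ring)]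
      exact Finsupp.sum_congr fun k _ => by rw [inv_zpow']
    have hσ := shiftSpectrum_eq_of_not_shiftBounded h1 hb hT
    rw [hγ χ _ hP.reflect]
    suffices h : ∃ v ∈ spectrum ℂ T, v ≠ 0 ∧
        ‖(χ.sum fun k c => c * w ^ k) - χ.sum fun k c => c * v ^ k‖ < ε by
      obtain ⟨v, hv, hv0, hlt⟩ := h
      refine ⟨v⁻¹, ?_, by rwa [hsum]⟩
      rw [hσ]
      exact ⟨inv_ne_zero hv0, by rwa [inv_inv]⟩
    -- Only `w = 0` has no inverse in `σ(S)`. A point of `σ(S)` gives a nonzero point `z⁻¹` of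
    -- `σ(T)`; the moduli form an interval, so `σ(T)` contains nonzero points arbitrarily close to
    -- `0`. There `χ` is a polynomial, hence continuous.
    by_cases hw0 : w = 0
    swap
    · exact ⟨w, hw, hw0, by rwa [sub_self, norm_zero]⟩
    subst hw0
    obtain ⟨z, hz⟩ := hne
    rw [hσ] at hz
    have hu : ¬ IsUnit T := by
      have := spectrum.mem_iff.1 hw
      rw [map_zero, zero_sub, IsUnit.neg_iff] at this
      exact this
    have hm : ∀ n : ℤ, n < -(0 : ℕ) → χ n = 0 := fun n hn =>
      hT.eq_zero_of_neg h1.reflect hu hP.reflect (by simpa using hn)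
    have heval : ∀ v : ℂ, (χ.sum fun k c => c * v ^ k) = (shiftedPoly χ 0).eval v := fun v => by
      rw [eval_shiftedPoly hm (Or.inr rfl), pow_zero, one_mul]
    obtain ⟨δ, hδ, hcont⟩ := Metric.continuous_iff.1 (shiftedPoly χ 0).continuous 0 ε hε
    have hzp : 0 < ‖z⁻¹‖ := norm_pos_iff.2 (inv_ne_zero hz.1)
    set s : ℝ := min 1 (δ / (2 * ‖z⁻¹‖)) with hs
    have hs0 : 0 < s := by positivity
    have hn : ‖(s : ℂ) * z⁻¹‖ = s * ‖z⁻¹‖ := by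
      rw [norm_mul, Complex.norm_real, Real.norm_of_nonneg hs0.le]
    refine ⟨s * z⁻¹, ?_, ?_, ?_⟩
    · refine hT.mem_spectrum_of_norm_le h1.reflect h2.reflect h3.reflect hw hz.2 ?_ ?_
      · rw [norm_zero]; exact norm_nonneg _
      · rw [hn]; exact mul_le_of_le_one_left hzp.le (min_le_left _ _)
    · exact mul_ne_zero (by exact_mod_cast hs0.ne') (inv_ne_zero hz.1)
    · rw [heval, heval, ← dist_eq_norm, dist_comm]
      refine hcont _ ?_
      rw [dist_zero_right, hn]
      calc s * ‖z⁻¹‖ ≤ δ / (2 * ‖z⁻¹‖) * ‖z⁻¹‖ :=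
            mul_le_mul_of_nonneg_right (min_le_right _ _) hzp.le
        _ < δ := by
            rw [div_mul_eq_mul_div, mul_div_mul_right _ _ hzp.ne']
            linarith

theorem memLp_and_fourierCoeff_finsupp_sum (φ : ℤ →₀ ℂ) (r : ℝ) :
    MemLp (fun t : UnitAddCircle => φ.sum fun k c => c * ((r : ℂ) * AddCircle.toCircle t) ^ k) ⊤
      AddCircle.haarAddCircle ∧
    ∀ n, fourierCoeff (fun t : UnitAddCircle =>
      φ.sum fun k c => c * ((r : ℂ) * AddCircle.toCircle t) ^ k) n = φ n * (r : ℂ) ^ n := by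
  have e : (fun t : UnitAddCircle => φ.sum fun k c => c * ((r : ℂ) * AddCircle.toCircle t) ^ k) =
      fun t => ∑' n, φ n * (r : ℂ) ^ n * fourier n t := by
    funext t
    rw [tsum_eq_sum (s := φ.support) fun n hn => by
      rw [Finsupp.notMem_support_iff.1 hn, zero_mul, zero_mul]]
    refine Finset.sum_congr rfl fun n _ => ?_
    change φ n * ((r : ℂ) * AddCircle.toCircle t) ^ n = _
    rw [mul_zpow, fourier_eq_zpow, mul_assoc]
  rw [e]
  refine fourierCoeff_tsum (summable_of_ne_finset_zero (s := φ.support) fun n hn => ?_)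
  rw [Finsupp.notMem_support_iff.1 hn, zero_mul, norm_zero]

theorem continuous_finsupp_sum_onCircle (φ : ℤ →₀ ℂ) (r : ℝ) :
    Continuous fun t : UnitAddCircle =>
      φ.sum fun k c => c * ((r : ℂ) * AddCircle.toCircle t) ^ k := by
  refine continuous_finsetSum _ fun k _ => continuous_const.mul ?_
  have : (fun t : UnitAddCircle => ((r : ℂ) * AddCircle.toCircle t) ^ k) =
      fun t => (r : ℂ) ^ k * fourier k t := by
    funext t
    rw [mul_zpow, fourier_eq_zpow]
  rw [this]
  exact continuous_const.mul (fourier k).continuous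

theorem spectrum_subset_closure_circularEssRange [CompleteSpace E] (h1 : X.H1) (h2 : X.H2)
    (h3 : X.H3) (hS : X.ShiftBounded ∨ X.ShiftInvBounded) (hne : X.shiftSpectrum.Nonempty)
    {M : E →L[ℂ] E} (hM : M ∈ X.convolutionAlgebra) {g : ℂ → ℂ} (hg : X.IsSymbol M g) :
    spectrum ℂ M ⊆ closure (circularEssRange g X.shiftSpectrum) := by
  have := X.nontrivial
  intro l hl
  obtain ⟨K, hK⟩ := exists_isSymbolDomain h1 h2 h3 hS
  obtain ⟨γ, hγ⟩ := exists_character_apply_eq h1 h2 hM hl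
  have hc : IsClosed (X.convolutionAlgebra : Set (E →L[ℂ] E)) :=
    Subalgebra.isClosed_topologicalClosure _
  have hMm := isMultiplier_of_mem_convolutionAlgebra h1 h2 hM
  by_contra hcl
  obtain ⟨ε, hε, hball⟩ := Metric.isOpen_iff.1 isClosed_closure.isOpen_compl l hcl
  have hK0 := hK.const_nonneg
  -- Replacing `M` by `P` costs `K * η` in the symbol on the circle. The value of `φ` at `z` is
  -- within `2 * η` of `l`: one `η` for `γ(P - M)` and one for the choice of `z`. The total stays
  -- below `ε = (K + 3) * η`.
  set η : ℝ := ε / (K + 3) with hη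
  have hη0 : 0 < η := by positivity
  obtain ⟨P, hPadj, hPM⟩ := Metric.mem_closure_iff.1
    (show M ∈ closure (Algebra.adjoin ℂ {T : E →L[ℂ] E | ∃ φ : ℤ →₀ ℂ, X.IsConvolution φ T} :
      Set (E →L[ℂ] E)) from hM) η hη0
  obtain ⟨φ, hP⟩ := exists_isConvolution_of_mem_adjoin h1 h2 hPadj
  obtain ⟨z, hz, hzη⟩ := exists_norm_character_sub_lt h1 h2 h3 hS hne γ hP hη0
  have hγP : ‖γ ⟨P, hP.mem_convolutionAlgebra⟩ - l‖ < η := by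
    rw [← hγ, ← map_sub]
    obtain ⟨v, hv, hle⟩ := exists_mem_spectrum_norm_apply_le hc γ
      (⟨P, hP.mem_convolutionAlgebra⟩ - ⟨M, hM⟩)
    refine (hle.trans (spectrum.norm_le_norm_of_mem hv)).trans_lt ?_
    rw [dist_comm, dist_eq_norm] at hPM
    exact hPM
  have hφz : ‖(φ.sum fun k c => c * z ^ k) - l‖ < 2 * η := by
    have := norm_sub_le_norm_sub_add_norm_sub (φ.sum fun k c => c * z ^ k)
      (γ ⟨P, hP.mem_convolutionAlgebra⟩) l
    rw [norm_sub_rev] at hzη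
    linarith
  have hsph := hK.sphere_subset hz
  set p : UnitAddCircle → ℂ := fun t =>
    φ.sum fun k c => c * ((‖z‖ : ℂ) * AddCircle.toCircle t) ^ k with hp
  obtain ⟨hpm, hpc⟩ := memLp_and_fourierCoeff_finsupp_sum φ ‖z‖
  obtain ⟨hgm, hgc⟩ := hg.2 ‖z‖ (norm_nonneg z) hsph
  have hdiff : X.IsMultiplier (M - P) := by
    intro a b ha hb
    rw [_root_.sub_apply, _root_.sub_apply, map_sub, map_sub, hMm a b ha hb,
      hP.isMultiplier a b ha hb, map_sub]
  have hae1 : ∀ᵐ t ∂AddCircle.haarAddCircle, ‖onCircle g ‖z‖ t - p t‖ ≤ K * ‖M - P‖ := by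
    have hneg := hpm.const_smul (-1 : ℂ)
    have := hK.ae_norm_le hdiff (norm_nonneg z) hsph (hgm.add hneg) fun n => by
      rw [fourierCoeff.add (hgm.integrable le_top) (hneg.integrable le_top), Pi.add_apply, hgc,
        fourierCoeff.const_smul, hpc, symbolCoeff, symbolCoeff, _root_.sub_apply, map_sub,
        Pi.sub_apply, ← hP.symbolCoeff, symbolCoeff, smul_eq_mul]
      ring
    filter_upwards [this] with t ht
    simpa [sub_eq_add_neg] using ht
  have hae2 : ∀ᵐ t ∂AddCircle.haarAddCircle, onCircle g ‖z‖ t ∉ Metric.ball l ε := by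
    have h0 : AddCircle.haarAddCircle (onCircle g ‖z‖ ⁻¹' Metric.ball l ε) = 0 := by
      refine measure_preimage_eq_zero_of_disjoint_essentialRange ?_
      rw [Set.disjoint_left]
      intro w hw hwr
      exact hball hw (subset_closure ⟨‖z‖, norm_nonneg z, hsph, hwr⟩)
    exact measure_eq_zero_iff_ae_notMem.1 h0
  have hKη : K * ‖M - P‖ ≤ K * η := by
    rw [dist_eq_norm] at hPM
    exact mul_le_mul_of_nonneg_left hPM.le hK0
  have hεη : ε = K * η + 3 * η := by rw [hη]; field_simp
  have hae3 : ∀ᵐ t ∂AddCircle.haarAddCircle, t ∉ {t | ‖p t - l‖ < 2 * η} := by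
    filter_upwards [hae1, hae2] with t ht1 ht2 hmem
    rw [Metric.mem_ball, dist_eq_norm, not_lt] at ht2
    have hmem' : ‖p t - l‖ < 2 * η := hmem
    have := norm_sub_le_norm_sub_add_norm_sub (onCircle g ‖z‖ t) (p t) l
    linarith
  -- The set is open and contains the angle of `z`, so it has positive measure, although `hae3`
  -- makes it null.
  have hopen : IsOpen {t | ‖p t - l‖ < 2 * η} :=
    isOpen_lt ((continuous_finsupp_sum_onCircle φ ‖z‖).sub continuous_const).norm continuous_const
  obtain ⟨t, ht⟩ := exists_mul_toCircle_eq z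
  refine (hopen.measure_pos AddCircle.haarAddCircle ⟨t, ?_⟩).ne'
    (measure_eq_zero_iff_ae_notMem.2 hae3)
  change ‖p t - l‖ < 2 * η
  simp only [hp, ht]
  exact hφz

end SequenceSpace

/-! ### The main theorem -/

theorem theorem2 {E : Type*} [NormedAddCommGroup E] [NormedSpace ℂ E] [CompleteSpace E]
    (X : SequenceSpace E) (h1 : X.H1) (h2 : X.H2) (h3 : X.H3)
    (hS : X.ShiftBounded ∨ X.ShiftInvBounded) :
    (∀ M : E →L[ℂ] E, X.IsMultiplier M →
      (∃ g : ℂ → ℂ, X.IsSymbol M g) ∧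
      ∀ g : ℂ → ℂ, X.IsSymbol M g →
        closure (circularEssRange g X.shiftSpectrum) ⊆ spectrum ℂ M) ∧
    (X.shiftSpectrum.Nonempty →
      ∀ M ∈ X.convolutionAlgebra,
        X.IsMultiplier M ∧
        ∀ g : ℂ → ℂ, X.IsSymbol M g →
          spectrum ℂ M = closure (circularEssRange g X.shiftSpectrum)) := by
  obtain ⟨K, hK⟩ := SequenceSpace.exists_isSymbolDomain h1 h2 h3 hS
  have hpart : ∀ M : E →L[ℂ] E, X.IsMultiplier M → ∀ g : ℂ → ℂ, X.IsSymbol M g →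
      closure (circularEssRange g X.shiftSpectrum) ⊆ spectrum ℂ M := by
    intro M hM g hg l hl
    by_contra hspec
    obtain ⟨N, hN, hMN⟩ := hM.exists_resolvent h1 h2 hS hspec
    obtain ⟨δ, hδ, h⟩ := hK.exists_ae_le_norm_sub h1 h2 h3 hM hN hMN
    exact notMem_closure_circularEssRange hδ
      (fun r hr hrA => h r hr hrA _ (hg.2 r hr hrA).1 (hg.2 r hr hrA).2) hl
  refine ⟨fun M hM => ⟨hK.exists_symbol hM, hpart M hM⟩, fun hne M hM => ?_⟩
  have hMm := SequenceSpace.isMultiplier_of_mem_convolutionAlgebra h1 h2 hM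
  exact ⟨hMm, fun g hg => Set.Subset.antisymm
    (SequenceSpace.spectrum_subset_closure_circularEssRange h1 h2 h3 hS hne hM hg)
    (hpart M hMm g hg)⟩

end
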